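/- Let $V=U\sqcup\{\delta\}$ be a finite set, $x_0\in U$, and let $G=(V,E)$, $E\subset V\times V$, be a directed graph without loops in which no edge has origin $\delta$, every $x\in U$ is joined to $\delta$ by a directed path, and $x_0$ is joined to every $x\in U$ by a directed path. Write $e=(\underline e,\overline e)$. Let $\alpha_e>0$ $(e\in E)$, put $\beta_x=\sum_{\underline e=x}\alpha_e$ $(x\in U)$ and $C_\alpha=\prod_{x\in U}\Gamma(\beta_x)/\prod_{e\in E}\Gamma(\alpha_e)$. *Environment.* Let $\tilde\Delta=\{p\in(0,1]^E:\ \sum_{\underline e=x}p_e=1\ \ \forall x\in U\}$, and let $\mathbb E^{(\alpha)}$ be the expectation for the Dirichlet law on $\tilde\Delta$ with density $C_\alpha\prod_e p_e^{\alpha_e-1}$ with respect to $\prod_{e\in\tilde E}dp_e$, where $\tilde E$ is obtained from $E$ by removing, for each $x\in U$, an arbitrary edge with origin $x$. For $p\in\tilde\Delta$ let $P_U$ be the transition matrix, restricted to $U\times U$, of the Markov chain with exit probabilities $(p_e)_{\underline e=x}$ at $x\in U$, stopped at $\delta$; let $G^p_U=(I-P_U)^{-1}$ and $z_e=G^p_U(x_0,\underline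 e)\,p_e$. *Bipartite graph.* Let $\hat G$ have vertices $x_-,x_+$ $(x\in U)$ and $\delta$, and edges $\hat e_x=(x_-,x_+)$ for $x\in U$ and, for $e=(x,y)\in E$, $\hat e=(x_+,y_-)$ if $y\ne\delta$, $\hat e=(x_+,\delta)$ if $y=\delta$; denote by $\hat E$ its set of edges and put $\alpha_{\hat e}=\alpha_e$, $\alpha_{\hat e_x}=-\beta_x$. Let $\Delta$ be the set of $z\in(0,\infty)^{\hat E}$ such that $\sum_{\underline f=v}z_f-\sum_{\overline f=v}z_f=\mathbf 1_{v=(x_0)_-}$ for every vertex $v\neq\delta$ of $\hat G$. A spanning tree of $G$ is a set of edges that contains no cycle and contains a path (edges being usable in both directions) between any two vertices; it is directed (towards $\delta$) if it contains exactly one edge with origin $x$ for each $x\in U$. For a directed spanning tree $T$ of $G$ let $\hat T=\{\hat e: e\in T\}\cup\{\hat e_x: x\in U\}$, write $\hat E\setminus\hat T=\{f_1,\dots,f_n\}$, and set $\omega_{\hat T}=\frac{dz_{f_1}}{z_{f_1}}\wedge\cdots\wedge\frac{dz_{f_n}}{z_{f_n}}$, positively oriented, so that integrating against $\omega_{\hat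 T}$ over $\Delta$ means integrating against $\prod_i z_{f_i}^{-1}dz_{f_i}$ in the coordinates $z_{f_1},\dots,z_{f_n}$. **Theorem.** For every directed spanning tree $T$ of $G$ and every $\lambda\in\mathbb C^E$ with $\Re\lambda_e>0$ for all $e\in E$, both sides of the following identity are well defined ($\det(I-P_U)\neq0$ for every $p\in\tilde\Delta$, and both integrals converge absolutely), and $$C_\alpha\int_\Delta e^{-\sum_{e\in E}\lambda_e z_{\hat e}}\Big(\prod_{f\in\hat E}z_f^{\alpha_f}\Big)\,\omega_{\hat T}=\mathbb E^{(\alpha)}\left[e^{-\sum_{e\in E}\lambda_e z_e}\,\frac{\prod_{e\in T}p_e}{\det(I-P_U)}\right].$$ Moreover, for every $p\in\tilde\Delta$ and $e\in E$, $z_e=G^p_U(x_0,\underline e)\,p_e$ is the expected number of crossings of the edge $e$, before hitting $\delta$, by the Markov chain started at $x_0$ with exit probabilities $p$. -/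

import Mathlib

open MeasureTheory
open scoped ENNReal

noncomputable section

/-- A directed graph without loops and without multiple edges on the vertex set
`V = U ⊔ {δ}`, encoded as `Option U` with `δ = none`.  The edges are indexed by `E`, and `e ↦ (tail e, head e)`
embeds `E` into `V × V`; no edge has origin `δ`, since `tail` takes values in `U`. -/
structure KilledGraph (U E : Type*) where
  tail : E → U
  head : E → Option U
  simple : ∀ e e', tail e = tail e' → head e = head e' → e = e'
  noLoop : ∀ e, head e ≠ some (tail e)

namespace KilledGraph

variable {U E : Type*} (G : KilledGraph U E)

/-- The edge `e` is `(a, b)`. -/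
def IsArc (e : E) (a b : Option U) : Prop := some (G.tail e) = a ∧ G.head e = b

/-- `S` contains a simple path from `a` to `b`, in which edges may be used in either direction. -/
def ContainsPath (S : Set E) (a b : Option U) : Prop :=
  ∃ (k : ℕ) (v : Fin (k + 1) → Option U) (e : Fin k → E),
    Function.Injective v ∧ v 0 = a ∧ v (Fin.last k) = b ∧ (∀ j, e j ∈ S) ∧
      ∀ j, G.IsArc (e j) (v j.castSucc) (v j.succ) ∨ G.IsArc (e j) (v j.succ) (v j.castSucc)

/-- `S` contains a directed simple path from `a` to `b`. -/
def ContainsDirectedPath (S : Set E) (a b : Option U) : Prop :=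
  ∃ (k : ℕ) (v : Fin (k + 1) → Option U) (e : Fin k → E),
    Function.Injective v ∧ v 0 = a ∧ v (Fin.last k) = b ∧ (∀ j, e j ∈ S) ∧
      ∀ j, G.IsArc (e j) (v j.castSucc) (v j.succ)

/-- `S` contains a simple cycle: distinct vertices `v 0, …, v k` and distinct edges, the
`j`-th of which joins `v j` and `v (j + 1)`, in either direction and with indices
modulo `k + 1`. -/
def ContainsCycle (S : Set E) : Prop :=
  ∃ (k : ℕ) (v : Fin (k + 1) → Option U) (e : Fin (k + 1) → E),
    Function.Injective v ∧ Function.Injective e ∧ (∀ j, e j ∈ S) ∧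
      ∀ j, G.IsArc (e j) (v j) (v (j + 1)) ∨ G.IsArc (e j) (v (j + 1)) (v j)

def IsSpanningTree (T : Finset E) : Prop :=
  ¬ G.ContainsCycle (T : Set E) ∧ ∀ a b : Option U, a ≠ b → G.ContainsPath (T : Set E) a b

/-- A spanning tree directed towards `δ`. -/
def IsDirectedSpanningTree (T : Finset E) : Prop :=
  G.IsSpanningTree T ∧ ∀ x : U, ∃! e, e ∈ T ∧ G.tail e = x

/-- Every vertex is connected to `δ`, and `x₀` to every vertex, by a directed simple path. -/
structure IsAdmissible (x₀ : U) : Prop where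
  toCemetery : ∀ x : U, G.ContainsDirectedPath Set.univ (some x) none
  fromBase : ∀ x : U, x ≠ x₀ → G.ContainsDirectedPath Set.univ (some x₀) (some x)

/-- The bipartite graph obtained by duplicating each `x ∈ U` into `x₋ = (false, x)` and
`x₊ = (true, x)`.  An edge `e = (x, y)` gives `ê = (x₊, y₋)` (indexed by `Sum.inl e`), or `(x₊, δ)` if
`y = δ`, and a vertex `x ∈ U` gives `ê_x = (x₋, x₊)` (indexed by `Sum.inr x`). -/
def hat : KilledGraph (Bool × U) (E ⊕ U) where
  tail := Sum.elim (fun e => (true, G.tail e)) (fun x => (false, x))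
  head := Sum.elim (fun e => (G.head e).map (fun y => (false, y))) (fun x => some (true, x))
  simple := by
    rintro (e | x) (e' | x') h₁ h₂
    · simp only [Sum.elim_inl, Prod.mk.injEq, true_and] at h₁ h₂
      exact congrArg _ (G.simple e e' h₁ (Option.map_injective (Prod.mk_right_injective _) h₂))
    · simp at h₁
    · simp at h₁
    · simpa using h₁
  noLoop := by
    rintro (e | x) <;> simp

variable [Fintype U] [DecidableEq U] [Fintype E] [DecidableEq E]

/-! ### Environments and the Markov chain -/

/-- The set of environments: weights in `(0, 1]` that sum to one at every vertex of `U`. -/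
def environments : Set (E → ℝ) :=
  {p | (∀ e, 0 < p e ∧ p e ≤ 1) ∧ ∀ x, ∑ e with G.tail e = x, p e = 1}

/-- The measure `∏ dp_e` on the environments, the product being over all edges but one chosen
edge `r x` with origin `x` for each `x ∈ U`. -/
def environmentVolume (r : U → E) : Measure G.environments :=
  (volume : Measure ({e : E // e ≠ r (G.tail e)} → ℝ)).comap
    (fun (p : G.environments) (e : {e : E // e ≠ r (G.tail e)}) => (p : E → ℝ) e)

/-- `β_x`, the sum of the weights of the edges with origin `x`. -/
def outWeight (α : E → ℝ) (x : U) : ℝ := ∑ e with G.tail e = x, α e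

/-- `C_α = ∏_x Γ(β_x) / ∏_e Γ(α_e)`. -/
def normConst (α : E → ℝ) : ℝ :=
  (∏ x, Real.Gamma (G.outWeight α x)) / ∏ e, Real.Gamma (α e)

/-- The law of the Dirichlet environment with weights `α`. -/
def dirichletLaw (r : U → E) (α : E → ℝ) : Measure G.environments :=
  (G.environmentVolume r).withDensity
    (fun p => ENNReal.ofReal (G.normConst α * ∏ e, (p : E → ℝ) e ^ (α e - 1)))

/-- Transition probabilities on `V`; the vertex `δ` is absorbing. -/
def step (p : E → ℝ) : Option U → Option U → ℝ
  | some x, b => ∑ e with G.tail e = x ∧ G.head e = b, p e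
  | none, b => if b = none then 1 else 0

/-- The transition matrix restricted to `U × U`. -/
def transitionMatrix (p : E → ℝ) : Matrix U U ℝ :=
  Matrix.of fun x y => G.step p (some x) (some y)

/-- The Green function `(I - P_U)⁻¹` of the chain killed at `δ`. -/
def green (p : E → ℝ) : Matrix U U ℝ := (1 - G.transitionMatrix p)⁻¹

/-- `z_e = G_U(x₀, tail e) p_e`. -/
def occupation (x₀ : U) (p : E → ℝ) (e : E) : ℝ := G.green p x₀ (G.tail e) * p e

/-- `X` is, under `ℙ`, a Markov chain on `V` started at `x₀`, stopped at `δ`, with exit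
probabilities `p`. -/
structure IsMarkovChain (x₀ : U) (p : E → ℝ) {Ω : Type*} [MeasurableSpace Ω] (ℙ : Measure Ω)
    (X : ℕ → Ω → Option U) : Prop where
  measurable : ∀ n b, MeasurableSet {ω | X n ω = b}
  law : ∀ (n : ℕ) (v : ℕ → Option U), ℙ {ω | ∀ i ≤ n, X i ω = v i} =
    if v 0 = some x₀ then ENNReal.ofReal (∏ i ∈ Finset.range n, G.step p (v i) (v (i + 1))) else 0

/-- The expected number of crossings of `e` by `X` before the hitting time of `δ`. -/
def expectedCrossings {Ω : Type*} [MeasurableSpace Ω] (ℙ : Measure Ω)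
    (X : ℕ → Ω → Option U) (e : E) : ℝ≥0∞ :=
  ∫⁻ ω, ∑' k : ℕ, Set.indicator
    {ω | (∀ j ≤ k, X j ω ≠ none) ∧ X k ω = some (G.tail e) ∧ X (k + 1) ω = G.head e} 1 ω ∂ℙ

/-! ### The arrangement and its hypergeometric integrals -/

def divergence (θ : E → ℝ) (x : U) : ℝ :=
  ∑ e with G.tail e = x, θ e - ∑ e with G.head e = some x, θ e

/-- The affine space `{z | div z = δ_{x₀}}`. -/
def flowSpace (x₀ : U) : Set (E → ℝ) := {z | G.divergence z = Pi.single x₀ 1}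

/-- The domain of the arrangement on which all `z_e` are positive. -/
def domain (x₀ : U) : Set (G.flowSpace x₀) := {z | ∀ e, 0 < (z : E → ℝ) e}

/-- For a spanning tree `T` with complement `{e₁, …, eₙ}`, the functions `z_{e₁}, …, z_{eₙ}` are
global affine coordinates on the flow space.  This is the measure defined there by
the positively oriented form `dz_{e₁} ∧ ⋯ ∧ dz_{eₙ}`, i.e. Lebesgue measure in these coordinates. -/
def coordVolume (x₀ : U) (T : Finset E) : Measure (G.flowSpace x₀) :=
  (volume : Measure ({e : E // e ∉ T} → ℝ)).comap
    (fun (z : G.flowSpace x₀) (e : {e : E // e ∉ T}) => (z : E → ℝ) e)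

/-- The coefficient of `e^{-⟨λ,z⟩} ∏_e z_e^{α_e} ω_T` with respect to `dz_{e₁} ∧ ⋯ ∧ dz_{eₙ}`, where
`ω_T = dz_{e₁}/z_{e₁} ∧ ⋯ ∧ dz_{eₙ}/z_{eₙ}` and `{e₁, …, eₙ}` is the complement of `T`. -/
def hyperIntegrand (T : Finset E) (α : E → ℝ) (l : E → ℂ) (z : E → ℝ) : ℂ :=
  Complex.exp (-∑ e, l e * (z e : ℂ)) * ((∏ e, z e ^ α e : ℝ) : ℂ) * ((∏ e ∈ Tᶜ, (z e)⁻¹ : ℝ) : ℂ)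

/-- The integral `∫_Δ e^{-⟨λ,z⟩} ∏_e z_e^{α_e} ω_T` converges absolutely. -/
def HyperIntegrable (x₀ : U) (T : Finset E) (α : E → ℝ) (l : E → ℂ) : Prop :=
  IntegrableOn (fun z : G.flowSpace x₀ => hyperIntegrand T α l z) (G.domain x₀)
    (G.coordVolume x₀ T)

/-- The hypergeometric integral `I_{Δ,T}(λ) = ∫_Δ e^{-⟨λ,z⟩} ∏_e z_e^{α_e} ω_T`. -/
def hyperIntegral (x₀ : U) (T : Finset E) (α : E → ℝ) (l : E → ℂ) : ℂ :=
  ∫ z in G.domain x₀, hyperIntegrand T α l (z : E → ℝ) ∂(G.coordVolume x₀ T)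

/-! ### Weights, trees and parameters on the bipartite graph -/

/-- The weights on the bipartite graph: `α_e` on `ê`, and `-β_x` on `ê_x`. -/
def hatWeight (α : E → ℝ) : E ⊕ U → ℝ := Sum.elim α (fun x => -G.outWeight α x)

/-- The tree of the bipartite graph associated with `T`: all `ê` with `e ∈ T`, and all `ê_x`. -/
def hatTree (T : Finset E) : Finset (E ⊕ U) := T.disjSum Finset.univ

/-- A function on the edges of the graph, extended by zero to the edges `ê_x`. -/
def hatParam (l : E → ℂ) : E ⊕ U → ℂ := Sum.elim l 0

end KilledGraph

end

/-!
Sending a positive flow `z` on the bipartite graph to the environment `p_e = z_e / z_{ê_x}`,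
`x = tail e`, is a bijection onto the environments: its inverse sends `p` to the expected numbers of
crossings of the edges and of visits of the vertices, because conservation of the flow says that
`z_{ê_x} = G_U(x₀, x)`.  In the coordinates off a directed spanning tree its Jacobian is
`det (1 - P_U)` divided by the product of `z_{ê_x}` over the coordinate edges.  The weights `-β_x`
make `∏ z_f ^ α_f` equal to `∏ p_e ^ α_e`, so that the change of variables turns one integrand into
the other.

For absolute convergence, expand `det (1 - P_U)` over the choices of one edge at every vertex: the
terms are nonnegative and `∏_{e ∈ T} p_e` is one of them, so that the integrand on the probabilistic
side is bounded by one.  The total mass of the Dirichlet law is finite because the volume does not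
depend on the omitted edges, and at each vertex one may omit an edge whose weight is at least
`1 / #E`.
-/

noncomputable section

/-- A nonnegative matrix whose row sums are at most one: the transition matrix of a Markov chain
that may be killed. -/
structure IsSubstochastic {n : Type*} [Fintype n] (A : Matrix n n ℝ) : Prop where
  nonneg : ∀ i j, 0 ≤ A i j
  sum_row_le_one : ∀ i, ∑ j, A i j ≤ 1

namespace IsSubstochastic

variable {n : Type*} [Fintype n] {A B : Matrix n n ℝ}

theorem le_one (hA : IsSubstochastic A) (i j : n) : A i j ≤ 1 :=
  (Finset.single_le_sum (fun k _ => hA.nonneg i k) (Finset.mem_univ j)).trans (hA.sum_row_le_one i)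

theorem mul (hA : IsSubstochastic A) (hB : IsSubstochastic B) : IsSubstochastic (A * B) where
  nonneg i j := Finset.sum_nonneg fun k _ => mul_nonneg (hA.nonneg i k) (hB.nonneg k j)
  sum_row_le_one i := by
    calc ∑ j, (A * B) i j = ∑ k, A i k * ∑ j, B k j := by
          simp only [Matrix.mul_apply, Finset.mul_sum]
          exact Finset.sum_comm
      _ ≤ ∑ k, A i k := Finset.sum_le_sum fun k _ =>
          mul_le_of_le_one_right (hA.nonneg i k) (hB.sum_row_le_one k)
      _ ≤ 1 := hA.sum_row_le_one i

variable [DecidableEq n]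

theorem one : IsSubstochastic (1 : Matrix n n ℝ) where
  nonneg i j := by rw [Matrix.one_apply]; split_ifs <;> simp
  sum_row_le_one i := by simp [Matrix.one_apply]

theorem pow (hA : IsSubstochastic A) : ∀ k : ℕ, IsSubstochastic (A ^ k)
  | 0 => by simpa only [pow_zero] using one
  | k + 1 => by simpa only [pow_succ] using (hA.pow k).mul hA

theorem sum_pow_apply_le (hA : IsSubstochastic A) (hdet : (1 - A).det ≠ 0) (N : ℕ) (i j : n) :
    ∑ k ∈ Finset.range N, (A ^ k) i j ≤ ∑ l, |(1 - A)⁻¹ l j| := by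
  have hgeom : ∑ k ∈ Finset.range N, A ^ k = (1 - A ^ N) * (1 - A)⁻¹ := by
    rw [← geom_sum_mul_neg, Matrix.mul_nonsing_inv_cancel_right _ _ hdet.isUnit]
  have hentry (l : n) : |(1 - A ^ N) i l| ≤ 1 :=
    abs_sub_le_iff.2
      ⟨by linarith [one.le_one i l, (hA.pow N).nonneg i l],
        by linarith [(hA.pow N).le_one i l, one.nonneg i l]⟩
  calc ∑ k ∈ Finset.range N, (A ^ k) i j = ∑ l, (1 - A ^ N) i l * (1 - A)⁻¹ l j := by
        rw [← Matrix.sum_apply, hgeom, Matrix.mul_apply]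
    _ ≤ ∑ l, |(1 - A)⁻¹ l j| := Finset.sum_le_sum fun l _ => by
        refine (le_abs_self _).trans ?_
        rw [abs_mul]
        exact mul_le_of_le_one_left (abs_nonneg _) (hentry l)

/-- The Neumann series converges as soon as `1` is not an eigenvalue, because its partial sums
`(1 - A ^ N) (1 - A)⁻¹` are bounded and nondecreasing. -/
theorem hasSum_pow (hA : IsSubstochastic A) (hdet : (1 - A).det ≠ 0) :
    HasSum (fun k : ℕ => A ^ k) (1 - A)⁻¹ := by
  have hsum : Summable fun k : ℕ => A ^ k :=
    Pi.summable.2 fun i => Pi.summable.2 fun j =>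
      summable_of_sum_range_le (fun k => (hA.pow k).nonneg i j) fun N =>
        hA.sum_pow_apply_le hdet N i j
  rw [Matrix.inv_eq_left_inv hsum.tsum_pow_mul_one_sub]
  exact hsum.hasSum

end IsSubstochastic

theorem det_one_sub_of_isNilpotent {n R : Type*} [Fintype n] [DecidableEq n] [CommRing R]
    [IsDomain R] {A : Matrix n n R} (hA : IsNilpotent A) : (1 - A).det = 1 := by
  have hchar : A.charpoly = Polynomial.X ^ Fintype.card n :=
    sub_eq_zero.1 (Matrix.isNilpotent_charpoly_sub_pow_of_isNilpotent hA).eq_zero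
  have heval := Matrix.eval_charpoly A 1
  rw [hchar] at heval
  simpa using heval.symm

theorem measurePreserving_of_involutive {V : Type*} [NormedAddCommGroup V] [NormedSpace ℝ V]
    [FiniteDimensional ℝ V] [MeasurableSpace V] [BorelSpace V] (μ : Measure V)
    [μ.IsAddHaarMeasure] {L : V →ₗ[ℝ] V} (hL : Function.Involutive L) :
    MeasurePreserving L μ μ := by
  have hdet : LinearMap.det L * LinearMap.det L = 1 := by
    rw [← LinearMap.det_comp, show L ∘ₗ L = LinearMap.id from LinearMap.ext hL, LinearMap.det_id]
  have habs : |(LinearMap.det L)⁻¹| = 1 := by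
    rcases mul_self_eq_one_iff.1 hdet with h | h <;> simp [h]
  refine ⟨(LinearMap.continuous_of_finiteDimensional L).measurable, ?_⟩
  rw [Measure.map_linearMap_addHaar_eq_smul_addHaar μ (left_ne_zero_of_mul_eq_one hdet), habs,
    ENNReal.ofReal_one, one_smul]

theorem comap_comp_of_measurePreserving {X Y Z : Type*} [MeasurableSpace X] [MeasurableSpace Y]
    [MeasurableSpace Z] {μ : Measure Y} {ν : Measure Z} {c : X → Y} {Φ : Y → Z}
    (hc : MeasurableEmbedding c) (hΦc : MeasurableEmbedding (Φ ∘ c))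
    (hΦ : MeasurePreserving Φ μ ν) (hinj : Function.Injective Φ) :
    ν.comap (Φ ∘ c) = μ.comap c := by
  ext S hS
  have hpre : Φ ⁻¹' (Φ ∘ c '' S) = c '' S := by
    rw [Set.image_comp, Set.preimage_image_eq _ hinj]
  rw [hΦc.comap_apply, hc.comap_apply, ← hpre,
    hΦ.measure_preimage (hΦc.measurableSet_image.2 hS).nullMeasurableSet]

theorem integrable_prod_indicator_rpow {ι : Type*} [Fintype ι] {a : ι → ℝ} (ha : ∀ i, -1 < a i) :
    Integrable fun q : ι → ℝ => ∏ i, (Set.Ioc (0 : ℝ) 1).indicator (· ^ a i) (q i) := by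
  refine Integrable.fintype_prod (f := fun i => (Set.Ioc (0 : ℝ) 1).indicator (· ^ a i)) fun i => ?_
  rw [integrable_indicator_iff measurableSet_Ioc,
    ← intervalIntegrable_iff_integrableOn_Ioc_of_le zero_le_one]
  exact intervalIntegral.intervalIntegrable_rpow' (ha i)

theorem rpow_le_rpow_neg_abs {c u : ℝ} (hc : 0 < c) (hcu : c ≤ u) (hu : u ≤ 1) (a : ℝ) :
    u ^ a ≤ c ^ (-|a|) :=
  (Real.rpow_le_rpow_of_exponent_ge (hc.trans_le hcu) hu (neg_abs_le a)).trans
    (Real.rpow_le_rpow_of_nonpos hc hcu (neg_nonpos.2 (abs_nonneg a)))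

theorem vecMul_eq_iff_eq_vecMul_inv {n R : Type*} [Fintype n] [DecidableEq n] [CommRing R]
    {A : Matrix n n R} (hA : IsUnit A.det) {v w : n → R} :
    Matrix.vecMul v A = w ↔ v = Matrix.vecMul w A⁻¹ := by
  constructor
  · rintro rfl
    rw [Matrix.vecMul_vecMul, Matrix.mul_nonsing_inv A hA, Matrix.vecMul_one]
  · rintro rfl
    rw [Matrix.vecMul_vecMul, Matrix.nonsing_inv_mul A hA, Matrix.vecMul_one]

namespace KilledGraph

variable {U E : Type*} {G : KilledGraph U E}

/-! ### Absorbing sections and the matrix-tree expansion -/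

/-- The successor map on `V` when every vertex `x ∈ U` is left along the edge `t x`. -/
def next (G : KilledGraph U E) (t : U → E) (a : Option U) : Option U :=
  a.bind fun x => G.head (t x)

/-- The walk that leaves every vertex `x ∈ U` along the edge `t x` always reaches `δ`. -/
def Absorbing (G : KilledGraph U E) (t : U → E) : Prop :=
  ∀ a, ∃ n, (G.next t)^[n] a = none

theorem next_iterate_none (t : U → E) (n : ℕ) : (G.next t)^[n] none = none :=
  Function.iterate_fixed rfl n

theorem containsCycle_of_mem_periodicPts {t : U → E} (ht : ∀ x, G.tail (t x) = x) {x : U}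
    (hx : some x ∈ Function.periodicPts (G.next t)) : G.ContainsCycle (Set.range t) := by
  obtain ⟨k, hk⟩ := Nat.exists_eq_succ_of_ne_zero
    (Function.minimalPeriod_pos_of_mem_periodicPts hx).ne'
  set orbit : ℕ → Option U := fun n => (G.next t)^[n] (some x)
  have hsome (n : ℕ) : ∃ y, orbit n = some y := by
    obtain ⟨m, hm, hper⟩ := hx
    refine Option.ne_none_iff_exists'.1 fun hnone => ?_
    have hreturn : (G.next t)^[n * m - n + n] (some x) = some x := by
      rw [Nat.sub_add_cancel (Nat.le_mul_of_pos_right n hm)]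
      exact hper.const_mul n
    rw [Function.iterate_add_apply, show (G.next t)^[n] (some x) = none from hnone,
      next_iterate_none] at hreturn
    exact Option.some_ne_none x hreturn.symm
  choose y hy using hsome
  have hinj : Function.Injective fun j : Fin (k + 1) => orbit j := fun i j hij =>
    Fin.ext (Function.iterate_injOn_Iio_minimalPeriod (hk ▸ i.2) (hk ▸ j.2) hij)
  have hsucc (j : Fin (k + 1)) : orbit (j + 1 : Fin (k + 1)) = G.next t (orbit j) := by
    have hval : ((j + 1 : Fin (k + 1)) : ℕ) =
        (j + 1) % Function.minimalPeriod (G.next t) (some x) := by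
      rw [hk, Fin.val_add]
      simp
    simp only [orbit, hval, Function.iterate_mod_minimalPeriod_eq, Function.iterate_succ_apply']
  refine ⟨k, fun j => orbit j, fun j => t (y j), hinj, fun i j hij => hinj ?_,
    fun j => ⟨_, rfl⟩, fun j => Or.inl ⟨by rw [ht, ← hy], ?_⟩⟩
  · have hyij : y i = y j := by simpa only [ht] using congrArg G.tail hij
    simp only [hy, hyij]
  · simp only [hsucc, hy, next, Option.bind_some]

theorem absorbing_of_not_containsCycle [Finite U] {t : U → E} (ht : ∀ x, G.tail (t x) = x)
    (hcyc : ¬ G.ContainsCycle (Set.range t)) : G.Absorbing t := by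
  intro a
  by_contra! hne
  obtain ⟨i, j, hij, hval⟩ := Finite.exists_ne_map_eq_of_infinite fun n => (G.next t)^[n] a
  wlog hlt : i < j generalizing i j
  · exact this j i hij.symm hval.symm (hij.symm.lt_of_le (not_lt.1 hlt))
  obtain ⟨x, hx⟩ := Option.ne_none_iff_exists'.1 (hne i)
  refine hcyc (containsCycle_of_mem_periodicPts ht (x := x)
    ⟨j - i, Nat.sub_pos_of_lt hlt, ?_⟩)
  rw [← hx, Function.IsPeriodicPt, Function.IsFixedPt, ← Function.iterate_add_apply,
    Nat.sub_add_cancel hlt.le]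
  exact hval.symm

theorem IsDirectedSpanningTree.exists_section [Fintype U] [DecidableEq E] {T : Finset E}
    (hT : G.IsDirectedSpanningTree T) :
    ∃ t : U → E, (∀ x, G.tail (t x) = x) ∧ G.Absorbing t ∧ T = Finset.univ.image t := by
  choose t ht using fun x => (hT.2 x).exists
  have hTt : T = Finset.univ.image t := by
    ext e
    simp only [Finset.mem_image, Finset.mem_univ, true_and]
    refine ⟨fun he => ⟨G.tail e, (hT.2 _).unique (ht _) ⟨he, rfl⟩⟩, ?_⟩
    rintro ⟨x, rfl⟩
    exact (ht x).1
  refine ⟨t, fun x => (ht x).2, absorbing_of_not_containsCycle (fun x => (ht x).2) ?_, hTt⟩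
  simpa only [hTt, Finset.coe_image, Finset.coe_univ, Set.image_univ] using hT.1.1

section SectionMatrix

variable [DecidableEq U]

/-- The transition matrix of the walk that leaves every vertex `x ∈ U` along the edge `t x`. -/
def sectionMatrix (G : KilledGraph U E) (t : U → E) : Matrix U U ℝ :=
  Matrix.of fun x y => if G.head (t x) = some y then 1 else 0

variable [Fintype U]

theorem sectionMatrix_mulVec (t : U → E) (v : U → ℝ) (x : U) :
    (G.sectionMatrix t).mulVec v x = (G.head (t x)).elim 0 v := by
  cases h : G.head (t x) <;> simp [Matrix.mulVec, dotProduct, sectionMatrix, h]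

theorem sectionMatrix_pow_apply (t : U → E) (n : ℕ) (x y : U) :
    (G.sectionMatrix t ^ n) x y = if (G.next t)^[n] (some x) = some y then 1 else 0 := by
  induction n generalizing x with
  | zero => simp [Matrix.one_apply]
  | succ n ih =>
    have hstep : (G.sectionMatrix t ^ (n + 1)) x y =
        (G.head (t x)).elim 0 fun z => (G.sectionMatrix t ^ n) z y := by
      rw [pow_succ']
      exact sectionMatrix_mulVec t _ x
    rw [hstep, Function.iterate_succ_apply, next, Option.bind_some]
    cases G.head (t x) with
    | none => simp only [Option.elim_none, next_iterate_none, reduceCtorEq, if_false]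
    | some z => exact ih z

theorem Absorbing.isNilpotent_sectionMatrix {t : U → E} (ht : G.Absorbing t) :
    IsNilpotent (G.sectionMatrix t) := by
  choose n hn using fun x : U => ht (some x)
  refine ⟨∑ x, n x, Matrix.ext fun x y => ?_⟩
  obtain ⟨m, hm⟩ := Nat.exists_eq_add_of_le' (Finset.single_le_sum_of_canonicallyOrdered
    (f := n) (Finset.mem_univ x))
  rw [sectionMatrix_pow_apply, hm, Function.iterate_add_apply, hn, next_iterate_none]
  rfl

theorem det_one_sub_sectionMatrix_of_not_absorbing {t : U → E} (ht : ¬ G.Absorbing t) :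
    (1 - G.sectionMatrix t).det = 0 := by
  classical
  let v : Option U → ℝ := fun a => if ∃ n, (G.next t)^[n] a = none then 0 else 1
  have hv_none : v none = 0 := if_pos ⟨0, rfl⟩
  have hv_next (a : Option U) : v (G.next t a) = v a := by
    have hiff : (∃ n, (G.next t)^[n] (G.next t a) = none) ↔ ∃ n, (G.next t)^[n] a = none := by
      refine ⟨fun ⟨n, hn⟩ => ⟨n + 1, hn⟩, fun ⟨n, hn⟩ => ⟨n, ?_⟩⟩
      rw [← Function.iterate_succ_apply, Function.iterate_succ_apply', hn]
      rfl
    simp only [v, hiff]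
  obtain ⟨a, ha⟩ := not_forall.1 ht
  obtain ⟨x, rfl⟩ := Option.ne_none_iff_exists'.1 fun h : a = none => ha ⟨0, h⟩
  refine Matrix.exists_mulVec_eq_zero_iff.1 ⟨fun y => v (some y), fun h => ?_, funext fun y => ?_⟩
  · have hvx : v (some x) = 1 := if_neg ha
    exact one_ne_zero (hvx.symm.trans (congrFun h x))
  · have helim : (G.head (t y)).elim 0 (fun z => v (some z)) = v (G.next t (some y)) := by
      rw [next, Option.bind_some]
      cases G.head (t y) with
      | none => exact hv_none.symm
      | some z => rfl
    rw [Matrix.sub_mulVec, Matrix.one_mulVec, Pi.sub_apply, sectionMatrix_mulVec, helim, hv_next,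
      sub_self, Pi.zero_apply]

theorem Absorbing.det_one_sub_sectionMatrix {t : U → E} (ht : G.Absorbing t) :
    (1 - G.sectionMatrix t).det = 1 :=
  det_one_sub_of_isNilpotent ht.isNilpotent_sectionMatrix

theorem det_one_sub_sectionMatrix_nonneg (t : U → E) : 0 ≤ (1 - G.sectionMatrix t).det := by
  by_cases ht : G.Absorbing t
  · exact ht.det_one_sub_sectionMatrix.symm ▸ zero_le_one
  · exact (det_one_sub_sectionMatrix_of_not_absorbing ht).ge

end SectionMatrix

section TransitionMatrix

variable [DecidableEq U] [Fintype E] {p : E → ℝ}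

theorem transitionMatrix_apply (p : E → ℝ) (x y : U) :
    G.transitionMatrix p x y = ∑ e with G.tail e = x ∧ G.head e = some y, p e := rfl

theorem sum_step [Fintype U] (p : E → ℝ) (x : U) :
    ∑ b, G.step p (some x) b = ∑ e with G.tail e = x, p e := by
  simp only [step, ← Finset.filter_filter]
  exact Finset.sum_fiberwise _ _ _

theorem isSubstochastic_transitionMatrix [Fintype U] (hp : p ∈ G.environments) :
    IsSubstochastic (G.transitionMatrix p) where
  nonneg x y := Finset.sum_nonneg fun e _ => (hp.1 e).1.le
  sum_row_le_one x := by
    calc ∑ y, G.transitionMatrix p x y ≤ ∑ b, G.step p (some x) b := by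
          rw [Fintype.sum_option]
          exact le_add_of_nonneg_left (Finset.sum_nonneg fun e _ => (hp.1 e).1.le)
      _ = 1 := by rw [sum_step, hp.2]

variable [Fintype U]

/-- The matrix-tree theorem: expanding `det (1 - P)` row by row over the choice of the edge with
which every vertex is left, only the choices that form a tree contribute. -/
theorem det_one_sub_transitionMatrix (hp : ∀ x, ∑ e with G.tail e = x, p e = 1) :
    (1 - G.transitionMatrix p).det =
      ∑ s ∈ Fintype.piFinset fun x => {e | G.tail e = x},
        (∏ x, p (s x)) * (1 - G.sectionMatrix s).det := by
  classical
  let row : U → E → U → ℝ := fun x e y =>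
    (1 : Matrix U U ℝ) x y - if G.head e = some y then 1 else 0
  have hrow : (1 - G.transitionMatrix p : Matrix U U ℝ) =
      fun x => ∑ e with G.tail e = x, p e • row x e := by
    ext x y
    simp only [Finset.sum_apply, Pi.smul_apply, smul_eq_mul, row, mul_sub, Finset.sum_sub_distrib,
      ← Finset.sum_mul, hp, one_mul, mul_ite, mul_one, mul_zero, ← Finset.sum_filter,
      Finset.filter_filter, Matrix.sub_apply, transitionMatrix_apply]
  calc (1 - G.transitionMatrix p).det
      = Matrix.detRowAlternating fun x => ∑ e with G.tail e = x, p e • row x e := by rw [hrow]; rfl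
    _ = ∑ s ∈ Fintype.piFinset fun x => {e | G.tail e = x},
          Matrix.detRowAlternating fun x => p (s x) • row x (s x) :=
        MultilinearMap.map_sum_finset _ _ _
    _ = ∑ s ∈ Fintype.piFinset fun x => {e | G.tail e = x},
          (∏ x, p (s x)) * (1 - G.sectionMatrix s).det :=
        Finset.sum_congr rfl fun s _ => MultilinearMap.map_smul_univ _ _ _

theorem prod_le_det_one_sub_transitionMatrix (hp : p ∈ G.environments) {t : U → E}
    (ht : ∀ x, G.tail (t x) = x) (habs : G.Absorbing t) :
    ∏ x, p (t x) ≤ (1 - G.transitionMatrix p).det := by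
  classical
  have hprod (s : U → E) : 0 ≤ ∏ x, p (s x) := Finset.prod_nonneg fun x _ => (hp.1 (s x)).1.le
  calc ∏ x, p (t x) = (∏ x, p (t x)) * (1 - G.sectionMatrix t).det := by
        rw [habs.det_one_sub_sectionMatrix, mul_one]
    _ ≤ (1 - G.transitionMatrix p).det := by
        rw [det_one_sub_transitionMatrix hp.2]
        exact Finset.single_le_sum
          (f := fun s : U → E => (∏ x, p (s x)) * (1 - G.sectionMatrix s).det)
          (fun s _ => mul_nonneg (hprod s) (det_one_sub_sectionMatrix_nonneg s))
          (Fintype.mem_piFinset.2 fun x => by simp [ht])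

theorem det_one_sub_transitionMatrix_pos (hp : p ∈ G.environments) {t : U → E}
    (ht : ∀ x, G.tail (t x) = x) (habs : G.Absorbing t) :
    0 < (1 - G.transitionMatrix p).det :=
  (Finset.prod_pos fun x _ => (hp.1 (t x)).1).trans_le
    (prod_le_det_one_sub_transitionMatrix hp ht habs)

end TransitionMatrix

/-! ### Green function and expected crossings -/

theorem IsAdmissible.containsDirectedPath {x₀ : U} (hG : G.IsAdmissible x₀) (x : U) :
    G.ContainsDirectedPath Set.univ (some x₀) (some x) := by
  by_cases hx : x = x₀
  · exact ⟨0, fun _ => some x, Fin.elim0,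
      fun i j _ => Subsingleton.elim (α := Fin 1) i j, hx ▸ rfl, rfl,
      fun j => j.elim0, fun j => j.elim0⟩
  · exact hG.fromBase x hx

section Green

variable [DecidableEq U] [Fintype E] {p : E → ℝ}

theorem step_tail_head (p : E → ℝ) (e : E) : G.step p (some (G.tail e)) (G.head e) = p e := by
  have hsingle : ({f | G.tail f = G.tail e ∧ G.head f = G.head e} : Finset E) = {e} := by
    ext f
    simp only [Finset.mem_filter_univ, Finset.mem_singleton]
    exact ⟨fun h => G.simple _ _ h.1 h.2, by rintro rfl; exact ⟨rfl, rfl⟩⟩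
  rw [step, hsingle, Finset.sum_singleton]

variable [Fintype U]

theorem hasSum_green (hp : p ∈ G.environments) (hdet : (1 - G.transitionMatrix p).det ≠ 0)
    (x y : U) : HasSum (fun k => (G.transitionMatrix p ^ k) x y) (G.green p x y) :=
  Pi.hasSum.1 (Pi.hasSum.1 ((isSubstochastic_transitionMatrix hp).hasSum_pow hdet) x) y

theorem green_nonneg (hp : p ∈ G.environments) (hdet : (1 - G.transitionMatrix p).det ≠ 0)
    (x y : U) : 0 ≤ G.green p x y :=
  (hasSum_green hp hdet x y).nonneg fun k =>
    ((isSubstochastic_transitionMatrix hp).pow k).nonneg x y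

theorem transitionMatrix_pow_pos_of_path (hp : p ∈ G.environments) {x : U} {k : ℕ}
    {v : Fin (k + 1) → Option U} {e : Fin k → E} (h0 : v 0 = some x)
    (harc : ∀ j, G.IsArc (e j) (v j.castSucc) (v j.succ)) (j : Fin (k + 1)) (y : U)
    (hy : v j = some y) : 0 < (G.transitionMatrix p ^ (j : ℕ)) x y := by
  induction j using Fin.induction generalizing y with
  | zero =>
    obtain rfl : x = y := Option.some.inj (h0.symm.trans hy)
    simp
  | succ j ih =>
    obtain ⟨htail, hhead⟩ := harc j
    have hP := isSubstochastic_transitionMatrix hp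
    have hedge : G.transitionMatrix p (G.tail (e j)) y = p (e j) := by
      rw [← step_tail_head (G := G) p (e j), hhead, hy]
      rfl
    rw [Fin.val_succ, pow_succ, Matrix.mul_apply]
    exact Finset.sum_pos' (fun z _ => mul_nonneg ((hP.pow j).nonneg x z) (hP.nonneg z y))
      ⟨G.tail (e j), Finset.mem_univ _,
        mul_pos (ih _ htail.symm) (hedge ▸ (hp.1 (e j)).1)⟩

theorem green_pos (hp : p ∈ G.environments) (hdet : (1 - G.transitionMatrix p).det ≠ 0) {x y : U}
    (hxy : G.ContainsDirectedPath Set.univ (some x) (some y)) : 0 < G.green p x y := by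
  obtain ⟨k, v, e, -, h0, hlast, -, harc⟩ := hxy
  have hP := isSubstochastic_transitionMatrix hp
  calc 0 < (G.transitionMatrix p ^ k) x y :=
        transitionMatrix_pow_pos_of_path hp h0 harc (Fin.last k) y hlast
    _ ≤ G.green p x y :=
        le_hasSum (hasSum_green hp hdet x y) k fun n _ => (hP.pow n).nonneg x y

theorem occupation_pos (hp : p ∈ G.environments) (hdet : (1 - G.transitionMatrix p).det ≠ 0)
    {x₀ : U} (hx₀ : ∀ x, G.ContainsDirectedPath Set.univ (some x₀) (some x)) (e : E) :
    0 < G.occupation x₀ p e :=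
  mul_pos (green_pos hp hdet (hx₀ _)) (hp.1 e).1

end Green

section Crossings

/-- The event that the process `X` has not been killed up to time `n` and sits at `x` at
time `n`. -/
def surviving {Ω : Type*} (X : ℕ → Ω → Option U) (n : ℕ) (x : U) : Set Ω :=
  {ω | (∀ i ≤ n, X i ω ≠ none) ∧ X n ω = some x}

variable [DecidableEq U] [Fintype E] {p : E → ℝ}

theorem step_nonneg (hp : p ∈ G.environments) (a b : Option U) : 0 ≤ G.step p a b := by
  cases a with
  | none => simp only [step]; split_ifs <;> simp
  | some x => exact Finset.sum_nonneg fun e _ => (hp.1 e).1.le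

namespace IsMarkovChain

variable {x₀ : U} {Ω : Type*} [MeasurableSpace Ω] {ℙ : Measure Ω} {X : ℕ → Ω → Option U}

theorem measurableSet_surviving (hX : G.IsMarkovChain x₀ p ℙ X) (n : ℕ) (x : U) :
    MeasurableSet (surviving X n x) := by
  simp only [surviving, Set.ofPred_and, Set.ofPred_forall]
  exact (MeasurableSet.iInter fun i => MeasurableSet.iInter fun _ =>
    (hX.measurable i none).compl).inter (hX.measurable n _)

theorem measurableSet_history (hX : G.IsMarkovChain x₀ p ℙ X) {n : ℕ}
    (w : Fin (n + 1) → Option U) :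
    MeasurableSet ((fun ω (i : Fin (n + 1)) => X i ω) ⁻¹' {w}) := by
  simp only [Set.preimage, Set.mem_singleton_iff, funext_iff, Set.ofPred_forall]
  exact MeasurableSet.iInter fun i => hX.measurable i (w i)

theorem measure_history_inter (hX : G.IsMarkovChain x₀ p ℙ X) (hp : p ∈ G.environments) {n : ℕ}
    (w : Fin (n + 1) → Option U) (b : Option U) :
    ℙ ((fun ω (i : Fin (n + 1)) => X i ω) ⁻¹' {w} ∩ {ω | X (n + 1) ω = b}) =
      ℙ ((fun ω (i : Fin (n + 1)) => X i ω) ⁻¹' {w}) *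
        ENNReal.ofReal (G.step p (w (Fin.last n)) b) := by
  let v : ℕ → Option U := fun i => if h : i < n + 1 then w ⟨i, h⟩ else b
  have hv_le (i : ℕ) (hi : i ≤ n) : v i = w ⟨i, Nat.lt_succ_of_le hi⟩ :=
    dif_pos (Nat.lt_succ_of_le hi)
  have hv_succ : v (n + 1) = b := dif_neg (lt_irrefl _)
  have hhist : (fun ω (i : Fin (n + 1)) => X i ω) ⁻¹' {w} = {ω | ∀ i ≤ n, X i ω = v i} := by
    ext ω
    simp only [Set.mem_preimage, Set.mem_singleton_iff, funext_iff, Set.mem_ofPred_eq]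
    exact ⟨fun h i hi => (h ⟨i, Nat.lt_succ_of_le hi⟩).trans (hv_le i hi).symm,
      fun h i => (h i (Nat.le_of_lt_succ i.2)).trans (hv_le i (Nat.le_of_lt_succ i.2))⟩
  have hhist_succ : {ω | ∀ i ≤ n, X i ω = v i} ∩ {ω | X (n + 1) ω = b} =
      {ω | ∀ i ≤ n + 1, X i ω = v i} := by
    ext ω
    simp only [Nat.le_succ_iff, or_imp, forall_and, forall_eq, hv_succ]
    rfl
  rw [hhist, hhist_succ, hX.law, hX.law, ite_mul, zero_mul, Finset.prod_range_succ,
    ENNReal.ofReal_mul (Finset.prod_nonneg fun i _ => step_nonneg hp _ _), hv_le n le_rfl, hv_succ]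
  rfl

theorem measure_surviving_inter [Finite U] (hX : G.IsMarkovChain x₀ p ℙ X) (hp : p ∈ G.environments)
    (n : ℕ) (x : U) (b : Option U) :
    ℙ (surviving X n x ∩ {ω | X (n + 1) ω = b}) =
      ℙ (surviving X n x) * ENNReal.ofReal (G.step p (some x) b) := by
  have := Fintype.ofFinite U
  let history : Ω → Fin (n + 1) → Option U := fun ω i => X i ω
  let H : Finset (Fin (n + 1) → Option U) := {w | (∀ i, w i ≠ none) ∧ w (Fin.last n) = some x}
  have hH : surviving X n x = history ⁻¹' H := by
    ext ω
    simp only [surviving, H, history, Set.mem_preimage, Finset.coe_filter_univ, Set.mem_ofPred_eq,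
      Fin.forall_iff, Nat.lt_succ_iff, Fin.val_last]
  have hmeas (w : Fin (n + 1) → Option U) : MeasurableSet (history ⁻¹' {w}) :=
    hX.measurableSet_history w
  have hsum (μ : Measure Ω) : μ (history ⁻¹' H) = ∑ w ∈ H, μ (history ⁻¹' {w}) :=
    (sum_measure_preimage_singleton H fun w _ => hmeas w).symm
  rw [← Measure.restrict_apply' (hX.measurable (n + 1) b), hH, hsum, hsum, Finset.sum_mul]
  refine Finset.sum_congr rfl fun w hw => ?_
  rw [Measure.restrict_apply' (hX.measurable (n + 1) b), hX.measure_history_inter hp,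
    (Finset.mem_filter_univ _).1 hw |>.2]

variable [Fintype U]

theorem measure_surviving (hX : G.IsMarkovChain x₀ p ℙ X) (hp : p ∈ G.environments)
    (n : ℕ) (y : U) :
    ℙ (surviving X n y) = ENNReal.ofReal ((G.transitionMatrix p ^ n) x₀ y) := by
  induction n generalizing y with
  | zero =>
    have hzero : surviving X 0 y = {ω | ∀ i ≤ 0, X i ω = some y} := by
      ext ω
      simp only [surviving, Nat.le_zero, forall_eq, Set.mem_ofPred_eq, and_iff_right_iff_imp]
      rintro h
      simp only [h, ne_eq, reduceCtorEq, not_false_eq_true]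
    rw [hzero, hX.law 0 fun _ => some y, Finset.prod_range_zero, pow_zero, Matrix.one_apply]
    simp only [Option.some.injEq, eq_comm (a := y), apply_ite ENNReal.ofReal, ENNReal.ofReal_zero]
  | succ n ih =>
    have hP := isSubstochastic_transitionMatrix hp
    have hunion : surviving X (n + 1) y =
        ⋃ x, surviving X n x ∩ {ω | X (n + 1) ω = some y} := by
      ext ω
      simp only [surviving, Nat.le_succ_iff, or_imp, forall_and, forall_eq, Set.mem_iUnion,
        Set.mem_inter_iff, Set.mem_ofPred_eq]
      refine ⟨fun h => ?_, fun ⟨x, h⟩ => ⟨⟨h.1.1, by simp [h.2]⟩, h.2⟩⟩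
      obtain ⟨x, hx⟩ := Option.ne_none_iff_exists'.1 (h.1.1 n le_rfl)
      exact ⟨x, ⟨h.1.1, hx⟩, h.2⟩
    have hdisj : Pairwise (Function.onFun Disjoint fun x =>
        surviving X n x ∩ {ω | X (n + 1) ω = some y}) := fun x x' hne =>
      Set.disjoint_left.2 fun ω h h' => hne (Option.some.inj (h.1.2.symm.trans h'.1.2))
    rw [hunion, measure_iUnion hdisj fun x =>
      (hX.measurableSet_surviving n x).inter (hX.measurable _ _), tsum_fintype, pow_succ,
      Matrix.mul_apply, ENNReal.ofReal_sum_of_nonneg fun x _ =>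
        mul_nonneg ((hP.pow n).nonneg _ _) (hP.nonneg _ _)]
    refine Finset.sum_congr rfl fun x _ => ?_
    rw [hX.measure_surviving_inter hp, ih, ENNReal.ofReal_mul ((hP.pow n).nonneg _ _)]
    rfl

theorem expectedCrossings_eq (hX : G.IsMarkovChain x₀ p ℙ X) (hp : p ∈ G.environments)
    (hdet : (1 - G.transitionMatrix p).det ≠ 0) (e : E) :
    G.expectedCrossings ℙ X e = ENNReal.ofReal (G.occupation x₀ p e) := by
  have hP := isSubstochastic_transitionMatrix hp
  have hcross (k : ℕ) : {ω | (∀ j ≤ k, X j ω ≠ none) ∧ X k ω = some (G.tail e) ∧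
      X (k + 1) ω = G.head e} = surviving X k (G.tail e) ∩ {ω | X (k + 1) ω = G.head e} :=
    Set.ext fun ω => and_assoc.symm
  have hmeas (k : ℕ) : MeasurableSet
      (surviving X k (G.tail e) ∩ {ω | X (k + 1) ω = G.head e}) :=
    (hX.measurableSet_surviving k _).inter (hX.measurable _ _)
  have hsum := (hasSum_green hp hdet x₀ (G.tail e)).mul_right (p e)
  calc G.expectedCrossings ℙ X e
      = ∑' k, ℙ (surviving X k (G.tail e) ∩ {ω | X (k + 1) ω = G.head e}) := by
        simp only [expectedCrossings, hcross]
        rw [lintegral_tsum fun k => (measurable_one.indicator (hmeas k)).aemeasurable]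
        simp only [lintegral_indicator_one (hmeas _)]
    _ = ∑' k, ENNReal.ofReal ((G.transitionMatrix p ^ k) x₀ (G.tail e) * p e) := by
        simp only [hX.measure_surviving_inter hp, hX.measure_surviving hp, step_tail_head,
          ENNReal.ofReal_mul ((hP.pow _).nonneg _ _)]
    _ = ENNReal.ofReal (G.occupation x₀ p e) := by
        rw [← ENNReal.ofReal_tsum_of_nonneg
          (fun k => mul_nonneg ((hP.pow k).nonneg _ _) (hp.1 e).1.le) hsum.summable, hsum.tsum_eq,
          occupation]

end IsMarkovChain

end Crossings

/-! ### Coordinates off a section -/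

section Coordinates

/-- The edges off the section `r` of `tail`; they index the coordinates on the affine space
of functions on the edges with prescribed sums over the edges with a common origin. -/
abbrev Coord (G : KilledGraph U E) (r : U → E) : Type _ := {e : E // e ≠ r (G.tail e)}

variable [DecidableEq U] [Fintype E] [DecidableEq E] {r s : U → E}

/-- The sum of the values `q` over the edges off the section `r` with origin `x`. -/
def coordSum (q : G.Coord r → ℝ) (x : U) : ℝ :=
  ∑ f ∈ ({f | G.tail f = x} : Finset (G.Coord r)), q f

/-- The function with given values `q` off the section `r` and with sum `c x` over the edges with
origin `x`. -/
def fiberExtend (G : KilledGraph U E) (r : U → E) (c : U → ℝ) (q : G.Coord r → ℝ) (e : E) : ℝ :=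
  if h : e ≠ r (G.tail e) then q ⟨e, h⟩ else c (G.tail e) - coordSum q (G.tail e)

theorem sum_tail_eq (hr : ∀ x, G.tail (r x) = x) (f : E → ℝ) (x : U) :
    ∑ e with G.tail e = x, f e = f (r x) + coordSum (fun e : G.Coord r => f e) x := by
  have hmem : r x ∈ ({e | G.tail e = x} : Finset E) := (Finset.mem_filter_univ _).2 (hr x)
  have herase : ({e | G.tail e = x} : Finset E).erase (r x) =
      ({e | e ≠ r (G.tail e) ∧ G.tail e = x} : Finset E) := by
    ext e
    simp only [Finset.mem_erase, Finset.mem_filter_univ]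
    exact and_congr_left fun h => by rw [h]
  rw [coordSum, Finset.sum_filter (s := (Finset.univ : Finset (G.Coord r))),
    ← Finset.add_sum_erase _ f hmem, herase, ← Finset.filter_filter, Finset.sum_filter]
  exact congrArg (f (r x) + ·) (Finset.sum_subtype _ (fun e => Finset.mem_filter_univ e) _)

@[simp]
theorem fiberExtend_coord (c : U → ℝ) (q : G.Coord r → ℝ) (e : G.Coord r) :
    G.fiberExtend r c q e = q e := dif_pos e.2

theorem fiberExtend_section (hr : ∀ x, G.tail (r x) = x) (c : U → ℝ) (q : G.Coord r → ℝ) (x : U) :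
    G.fiberExtend r c q (r x) = c x - coordSum q x := by
  rw [fiberExtend, dif_neg (by rw [hr, not_not]), hr]

theorem sum_fiberExtend (hr : ∀ x, G.tail (r x) = x) (c : U → ℝ) (q : G.Coord r → ℝ) (x : U) :
    ∑ e with G.tail e = x, G.fiberExtend r c q e = c x := by
  simp only [sum_tail_eq hr, fiberExtend_section hr, fiberExtend_coord, sub_add_cancel]

theorem fiberExtend_restrict (hr : ∀ x, G.tail (r x) = x) {c : U → ℝ} {f : E → ℝ}
    (hf : ∀ x, ∑ e with G.tail e = x, f e = c x) : G.fiberExtend r c (fun e => f e) = f := by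
  ext e
  by_cases h : e = r (G.tail e)
  · rw [h, fiberExtend_section hr, ← hf, sum_tail_eq hr, add_sub_cancel_right]
  · exact fiberExtend_coord c _ ⟨e, h⟩

theorem fiberExtend_add (c c' : U → ℝ) (q q' : G.Coord r → ℝ) :
    G.fiberExtend r (c + c') (q + q') = G.fiberExtend r c q + G.fiberExtend r c' q' := by
  ext e
  simp only [fiberExtend, coordSum, Pi.add_apply, Finset.sum_add_distrib]
  split_ifs
  · rfl
  · ring

theorem fiberExtend_smul (a : ℝ) (q : G.Coord r → ℝ) :
    G.fiberExtend r 0 (a • q) = a • G.fiberExtend r 0 q := by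
  ext e
  simp only [fiberExtend, coordSum, Pi.smul_apply, smul_eq_mul, Pi.zero_apply, ← Finset.mul_sum]
  split_ifs
  · rfl
  · ring

end Coordinates

section Exchange

variable [DecidableEq E] {r s : U → E}

theorem tail_swap_section (hr : ∀ x, G.tail (r x) = x) (hs : ∀ x, G.tail (s x) = x) (e : E) :
    G.tail (Equiv.swap (r (G.tail e)) (s (G.tail e)) e) = G.tail e := by
  rw [Equiv.swap_apply_def]
  split_ifs
  · exact hs _
  · exact hr _
  · rfl

/-- The permutation of the edges that exchanges `r x` and `s x` for every vertex `x`. -/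
def exchange (hr : ∀ x, G.tail (r x) = x) (hs : ∀ x, G.tail (s x) = x) : Equiv.Perm E :=
  Function.Involutive.toPerm (fun e => Equiv.swap (r (G.tail e)) (s (G.tail e)) e) fun e => by
    simp only [tail_swap_section hr hs, Equiv.swap_apply_self]

variable (hr : ∀ x, G.tail (r x) = x) (hs : ∀ x, G.tail (s x) = x)

theorem exchange_exchange (e : E) : exchange hr hs (exchange hr hs e) = e :=
  (exchange hr hs).left_inv e

theorem tail_exchange (e : E) : G.tail (exchange hr hs e) = G.tail e := tail_swap_section hr hs e

theorem exchange_section (x : U) : exchange hr hs (r x) = s x := by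
  change Equiv.swap (r (G.tail (r x))) (s (G.tail (r x))) (r x) = s x
  rw [hr, Equiv.swap_apply_left]

/-- The bijection induced by `exchange` between the coordinates off `r` and those off `s`. -/
def coordEquiv : G.Coord r ≃ G.Coord s :=
  (exchange hr hs).subtypeEquiv fun e => by
    rw [tail_exchange, ← exchange_section hr hs, (exchange hr hs).injective.ne_iff]

variable [DecidableEq U] [Fintype E]

/-- The change from the coordinates off `r` to those off `s`, transported to the former by
`exchange`, on the functions with fibre sums `c`. -/
def exchangeCoord (c : U → ℝ) (q : G.Coord r → ℝ) (e : G.Coord r) : ℝ :=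
  G.fiberExtend r c q (exchange hr hs e)

theorem fiberExtend_exchangeCoord (c : U → ℝ) (q : G.Coord r → ℝ) :
    G.fiberExtend r c (exchangeCoord hr hs c q) = G.fiberExtend r c q ∘ exchange hr hs := by
  refine fiberExtend_restrict (f := G.fiberExtend r c q ∘ exchange hr hs) hr fun x => ?_
  rw [← sum_fiberExtend hr c q x]
  exact Finset.sum_equiv (exchange hr hs)
    (fun e => by simp only [Finset.mem_filter_univ, tail_exchange]) fun e _ => rfl

theorem involutive_exchangeCoord (c : U → ℝ) :
    Function.Involutive (exchangeCoord hr hs c : (G.Coord r → ℝ) → G.Coord r → ℝ) := fun q => by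
  ext e
  rw [exchangeCoord, fiberExtend_exchangeCoord, Function.comp_apply, exchange_exchange,
    fiberExtend_coord]

theorem measurePreserving_exchangeCoord (c : U → ℝ) :
    MeasurePreserving (exchangeCoord hr hs c : (G.Coord r → ℝ) → G.Coord r → ℝ) := by
  let L : (G.Coord r → ℝ) →ₗ[ℝ] (G.Coord r → ℝ) :=
    { toFun := exchangeCoord hr hs 0
      map_add' := fun q q' => funext fun e => by
        simpa only [add_zero] using! congrFun (fiberExtend_add 0 0 q q') (exchange hr hs e)
      map_smul' := fun a q => funext fun e => congrFun (fiberExtend_smul a q) (exchange hr hs e) }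
  have haffine : (exchangeCoord hr hs c : (G.Coord r → ℝ) → G.Coord r → ℝ) =
      (exchangeCoord hr hs c 0 + ·) ∘ L := by
    ext q e
    simpa only [add_zero, zero_add] using!
      congrFun (fiberExtend_add c 0 0 q) (exchange hr hs e)
  rw [haffine]
  exact (measurePreserving_add_left volume _).comp
    (measurePreserving_of_involutive volume (involutive_exchangeCoord hr hs 0))

end Exchange

section EnvironmentVolume

variable [DecidableEq U] [Fintype E]

theorem measurableSet_environments [Countable U] : MeasurableSet G.environments := by
  simp only [environments, Set.ofPred_and, Set.ofPred_forall]
  exact (MeasurableSet.iInter fun e =>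
    (measurableSet_lt measurable_const (measurable_pi_apply e)).inter
      (measurableSet_le (measurable_pi_apply e) measurable_const)).inter
    (MeasurableSet.iInter fun x => measurableSet_eq_fun (by fun_prop) measurable_const)

/-- The coordinates off the section `r` of an environment. -/
def envCoord (r : U → E) (p : G.environments) (e : G.Coord r) : ℝ := (p : E → ℝ) e

variable {r s : U → E}

theorem environmentVolume_eq [DecidableEq E] (r : U → E) :
    G.environmentVolume r = volume.comap (envCoord r) := rfl

theorem fiberExtend_envCoord [DecidableEq E] (hr : ∀ x, G.tail (r x) = x) (p : G.environments) :
    G.fiberExtend r 1 (envCoord r p) = p :=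
  fiberExtend_restrict hr p.2.2

theorem measurableEmbedding_envCoord [Countable U] (hr : ∀ x, G.tail (r x) = x) :
    MeasurableEmbedding (envCoord (G := G) r) := by
  classical
  have := (measurableSet_environments (G := G)).standardBorel
  refine Measurable.measurableEmbedding (measurable_pi_lambda _ fun e =>
    (measurable_pi_apply (e : E)).comp measurable_subtype_coe) fun p p' h => Subtype.ext ?_
  rw [← fiberExtend_envCoord hr p, ← fiberExtend_envCoord hr p', h]

theorem environmentVolume_congr [Countable U] [DecidableEq E] (hr : ∀ x, G.tail (r x) = x)
    (hs : ∀ x, G.tail (s x) = x) : G.environmentVolume r = G.environmentVolume s := by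
  let reindex := MeasurableEquiv.arrowCongr' (coordEquiv hr hs) (MeasurableEquiv.refl ℝ)
  have hcomp : envCoord (G := G) s = (reindex ∘ exchangeCoord hr hs 1) ∘ envCoord r := by
    ext p f
    obtain ⟨e, rfl⟩ := (coordEquiv hr hs).surjective f
    simp [reindex, MeasurableEquiv.arrowCongr', Equiv.arrowCongr', Equiv.arrowCongr,
      exchangeCoord, fiberExtend_envCoord hr]
    rfl
  rw [environmentVolume_eq, environmentVolume_eq, hcomp]
  refine (comap_comp_of_measurePreserving (measurableEmbedding_envCoord hr)
    (hcomp ▸ measurableEmbedding_envCoord hs) ?_ ?_).symm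
  · exact (volume_preserving_arrowCongr' _ _ (MeasurePreserving.id volume)).comp
      (measurePreserving_exchangeCoord hr hs 1)
  · exact reindex.injective.comp (involutive_exchangeCoord hr hs 1).injective

end EnvironmentVolume

/-! ### Integrability on the environments -/

@[to_additive]
theorem prod_eq_prod_section_mul {M : Type*} [CommMonoid M] [Fintype U] [Fintype E] [DecidableEq E]
    {s : U → E} (hs : ∀ x, G.tail (s x) = x) (f : E → M) :
    ∏ e, f e = (∏ x, f (s x)) * ∏ e : G.Coord s, f e := by
  rw [← Finset.prod_filter_mul_prod_filter_not Finset.univ (fun e => e = s (G.tail e))]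
  congr 1
  · exact Finset.prod_nbij' G.tail s (fun _ _ => Finset.mem_univ _)
      (fun x _ => (Finset.mem_filter_univ _).2 (by rw [hs]))
      (fun e he => ((Finset.mem_filter_univ e).1 he).symm) (fun x _ => hs x)
      (fun e he => congrArg f ((Finset.mem_filter_univ e).1 he))
  · exact Finset.prod_subtype _ (fun e => Finset.mem_filter_univ e) f

theorem prod_image_section {M : Type*} [CommMonoid M] [Fintype U] [DecidableEq E]
    {t : U → E} (ht : ∀ x, G.tail (t x) = x) (f : E → M) :
    ∏ e ∈ Finset.univ.image t, f e = ∏ x, f (t x) :=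
  Finset.prod_image fun x _ y _ h => by rw [← ht x, h, ht]

section Dirichlet

variable [DecidableEq U] [Fintype E] {r s : U → E} {α : E → ℝ}

theorem exists_section_inv_card_le {p : E → ℝ} (hp : p ∈ G.environments) :
    ∃ s : U → E, (∀ x, G.tail (s x) = x) ∧ ∀ x, (Fintype.card E : ℝ)⁻¹ ≤ p (s x) := by
  have hmax : ∀ x, ∃ e ∈ ({e | G.tail e = x} : Finset E), (Fintype.card E : ℝ)⁻¹ ≤ p e := by
    intro x
    have hne : ({e | G.tail e = x} : Finset E).Nonempty :=
      Finset.nonempty_of_sum_ne_zero (by rw [hp.2 x]; exact one_ne_zero)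
    refine Finset.exists_le_of_sum_le hne ?_
    rw [hp.2 x, Finset.sum_const, nsmul_eq_mul]
    exact mul_inv_le_one_of_le₀ (Nat.cast_le.2 (Finset.card_le_univ _)) (Nat.cast_nonneg _)
  choose s hs using hmax
  exact ⟨s, fun x => (Finset.mem_filter_univ (s x)).1 (hs x).1, fun x => (hs x).2⟩

theorem measurable_environment_apply (e : E) :
    Measurable fun p : G.environments => (p : E → ℝ) e :=
  (measurable_pi_apply e).comp measurable_subtype_coe

theorem outWeight_pos (hr : ∀ x, G.tail (r x) = x) (hα : ∀ e, 0 < α e) (x : U) :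
    0 < G.outWeight α x :=
  Finset.sum_pos (fun e _ => hα e) ⟨r x, (Finset.mem_filter_univ _).2 (hr x)⟩

theorem normConst_pos [Fintype U] (hr : ∀ x, G.tail (r x) = x) (hα : ∀ e, 0 < α e) :
    0 < G.normConst α :=
  div_pos (Finset.prod_pos fun x _ => Real.Gamma_pos_of_pos (outWeight_pos hr hα x))
    (Finset.prod_pos fun e _ => Real.Gamma_pos_of_pos (hα e))

variable [DecidableEq E]

theorem integrableOn_prod_rpow_of_le [Finite U] (hs : ∀ x, G.tail (s x) = x)
    (hα : ∀ e, -1 < α e) {c : ℝ} (hc : 0 < c) :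
    IntegrableOn (fun p : G.environments => ∏ e, (p : E → ℝ) e ^ α e)
      {p | ∀ x, c ≤ (p : E → ℝ) (s x)} (G.environmentVolume s) := by
  have := Fintype.ofFinite U
  have hcoord : Integrable (fun p : G.environments => ∏ e : G.Coord s, (p : E → ℝ) e ^ α e)
      (G.environmentVolume s) := by
    have hrange := (integrable_prod_indicator_rpow fun e : G.Coord s => hα e).restrict
      (s := Set.range (envCoord s))
    rw [← (measurableEmbedding_envCoord hs).map_comap,
      (measurableEmbedding_envCoord hs).integrable_map_iff] at hrange
    refine hrange.congr (.of_forall fun p => Finset.prod_congr rfl fun e _ => ?_)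
    exact Set.indicator_of_mem (s := Set.Ioc (0 : ℝ) 1) (p.2.1 e) _
  refine (hcoord.const_mul (∏ x, c ^ (-|α (s x)|))).integrableOn.mono'
    (Finset.measurable_prod _ fun e _ =>
      (measurable_environment_apply e).pow_const _).aestronglyMeasurable
    ((ae_restrict_iff' ?_).2 (.of_forall fun p hp => ?_))
  · simp only [Set.ofPred_forall]
    exact MeasurableSet.iInter fun x => measurableSet_le measurable_const
      (measurable_environment_apply _)
  · have hpow : ∀ e, 0 ≤ (p : E → ℝ) e ^ α e := fun e => Real.rpow_nonneg (p.2.1 e).1.le _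
    rw [Real.norm_of_nonneg (Finset.prod_nonneg fun e _ => hpow e), prod_eq_prod_section_mul hs]
    exact mul_le_mul_of_nonneg_right (Finset.prod_le_prod (fun x _ => hpow _) fun x _ =>
      rpow_le_rpow_neg_abs hc (hp x) (p.2.1 _).2 _) (Finset.prod_nonneg fun e _ => hpow e)

/- At every vertex some weight is at least `1 / #E`, so it is bounded away from zero.  Since the
measure does not depend on the section, the omitted coordinates may be taken to be such weights. -/
theorem integrable_prod_rpow [Finite U] (hr : ∀ x, G.tail (r x) = x) (hα : ∀ e, -1 < α e) :
    Integrable (fun p : G.environments => ∏ e, (p : E → ℝ) e ^ α e) (G.environmentVolume r) := by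
  let A : {s : U → E // ∀ x, G.tail (s x) = x} → Set G.environments := fun s =>
    {p | ∀ x, (Fintype.card E : ℝ)⁻¹ ≤ (p : E → ℝ) (s.1 x)}
  have hcover : ⋃ s, A s = Set.univ := Set.eq_univ_of_forall fun p =>
    let ⟨s, hs, hle⟩ := exists_section_inv_card_le p.2
    Set.mem_iUnion.2 ⟨⟨s, hs⟩, hle⟩
  rw [← integrableOn_univ, ← hcover, integrableOn_finite_iUnion]
  rintro ⟨s, hs⟩
  rw [environmentVolume_congr hr hs]
  rcases isEmpty_or_nonempty E with _ | _
  · have : IsEmpty U := ⟨fun x => isEmptyElim (r x)⟩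
    exact (integrableOn_prod_rpow_of_le hs hα one_pos).mono_set fun p _ => isEmptyElim
  · exact integrableOn_prod_rpow_of_le hs hα (inv_pos.2 (Nat.cast_pos.2 Fintype.card_pos))

theorem isFiniteMeasure_dirichletLaw [Fintype U] (hr : ∀ x, G.tail (r x) = x) (hα : ∀ e, 0 < α e) :
    IsFiniteMeasure (G.dirichletLaw r α) :=
  isFiniteMeasure_withDensity_ofReal ((integrable_prod_rpow hr fun e => by
    linarith [hα e]).const_mul (G.normConst α)).2

end Dirichlet

section LaplaceFunctional

variable [DecidableEq U] [Fintype E]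

theorem continuous_one_sub_transitionMatrix : Continuous fun p => 1 - G.transitionMatrix p := by
  refine continuous_const.sub (continuous_matrix fun x y => ?_)
  simp only [transitionMatrix_apply]
  fun_prop

variable [Fintype U]

/-- The function of the environment whose expectation is the right-hand side of the identity. -/
def laplaceFunctional (G : KilledGraph U E) (x₀ : U) (T : Finset E) (l : E → ℂ) (p : E → ℝ) : ℂ :=
  Complex.exp (-∑ e, l e * (G.occupation x₀ p e : ℂ)) *
    (((∏ e ∈ T, p e) / (1 - G.transitionMatrix p).det : ℝ) : ℂ)

theorem continuousOn_laplaceFunctional (x₀ : U) (T : Finset E) (l : E → ℂ) :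
    ContinuousOn (G.laplaceFunctional x₀ T l) {p | (1 - G.transitionMatrix p).det ≠ 0} := by
  have hdet : Continuous fun p => (1 - G.transitionMatrix p).det :=
    continuous_one_sub_transitionMatrix.matrix_det
  have hgreen : ContinuousOn G.green {p | (1 - G.transitionMatrix p).det ≠ 0} := by
    refine ContinuousOn.congr (f := fun p => (1 - G.transitionMatrix p).det⁻¹ •
      (1 - G.transitionMatrix p).adjugate) ?_ fun p _ => ?_
    · exact (hdet.continuousOn.inv₀ fun p hp => hp).smul
        continuous_one_sub_transitionMatrix.matrix_adjugate.continuousOn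
    · rw [green, Matrix.inv_def, Ring.inverse_eq_inv']
  have hoccupation : ∀ e, ContinuousOn (fun p => G.occupation x₀ p e)
      {p | (1 - G.transitionMatrix p).det ≠ 0} := fun e =>
    ((continuous_id.matrix_elem x₀ (G.tail e)).comp_continuousOn hgreen).mul
      (continuous_apply e).continuousOn
  refine ContinuousOn.mul (Complex.continuous_exp.comp_continuousOn
    (continuousOn_finsetSum _ fun e _ => continuousOn_const.mul
      (Complex.continuous_ofReal.comp_continuousOn (hoccupation e))).neg) ?_
  exact Complex.continuous_ofReal.comp_continuousOn
    ((Continuous.continuousOn (by fun_prop)).div hdet.continuousOn fun p hp => hp)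

variable [DecidableEq E] {t : U → E} {p : E → ℝ} {l : E → ℂ}

theorem norm_laplaceFunctional_le_one (hp : p ∈ G.environments) (ht : ∀ x, G.tail (t x) = x)
    (habs : G.Absorbing t) (x₀ : U) (hl : ∀ e, 0 ≤ (l e).re) :
    ‖G.laplaceFunctional x₀ (Finset.univ.image t) l p‖ ≤ 1 := by
  have hdet := det_one_sub_transitionMatrix_pos hp ht habs
  rw [laplaceFunctional, norm_mul, Complex.norm_exp, Complex.norm_real, prod_image_section ht]
  refine mul_le_one₀ (Real.exp_le_one_iff.2 ?_) (norm_nonneg _) ?_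
  · simp only [Complex.neg_re, Complex.re_sum, Complex.re_mul_ofReal, neg_nonpos]
    exact Finset.sum_nonneg fun e _ => mul_nonneg (hl e)
      (mul_nonneg (green_nonneg hp hdet.ne' _ _) (hp.1 e).1.le)
  · rw [Real.norm_of_nonneg (div_nonneg (Finset.prod_nonneg fun x _ => (hp.1 _).1.le) hdet.le)]
    exact div_le_one_of_le₀ (prod_le_det_one_sub_transitionMatrix hp ht habs) hdet.le

theorem integrable_laplaceFunctional {r : U → E} (hr : ∀ x, G.tail (r x) = x) {α : E → ℝ}
    (hα : ∀ e, 0 < α e) (ht : ∀ x, G.tail (t x) = x) (habs : G.Absorbing t) (x₀ : U)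
    (hl : ∀ e, 0 ≤ (l e).re) :
    Integrable (fun p : G.environments => G.laplaceFunctional x₀ (Finset.univ.image t) l p)
      (G.dirichletLaw r α) := by
  have := isFiniteMeasure_dirichletLaw hr hα
  refine .of_bound (Continuous.aestronglyMeasurable ?_) 1
    (.of_forall fun p => norm_laplaceFunctional_le_one p.2 ht habs x₀ hl)
  exact (continuousOn_laplaceFunctional x₀ _ l).comp_continuous continuous_subtype_val fun p =>
    (det_one_sub_transitionMatrix_pos p.2 ht habs).ne'

end LaplaceFunctional

/-! ### Flows and environments -/

section HeadMatrix

variable [DecidableEq U]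

/-- The incidence matrix of the edges and their end points in `U`. -/
def headMatrix (G : KilledGraph U E) : Matrix E U ℝ :=
  Matrix.of fun e y => if G.head e = some y then 1 else 0

variable [Fintype E]

theorem vecMul_headMatrix (θ : E → ℝ) (y : U) :
    Matrix.vecMul θ G.headMatrix y = ∑ e with G.head e = some y, θ e := by
  simp only [Matrix.vecMul, dotProduct, headMatrix, Matrix.of_apply, mul_ite, mul_one, mul_zero,
    Finset.sum_filter]

theorem outWeight_tail_mul {p : E → ℝ} (hp : ∀ x, ∑ e with G.tail e = x, p e = 1) (g : U → ℝ) :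
    G.outWeight (fun e => g (G.tail e) * p e) = g := by
  ext x
  rw [outWeight, ← mul_one (g x), ← hp x, Finset.mul_sum]
  exact Finset.sum_congr rfl fun e he => by rw [(Finset.mem_filter_univ e).1 he]

variable [Fintype U]

theorem sum_mul_tail (θ : E → ℝ) (v : U → ℝ) :
    ∑ e, θ e * v (G.tail e) = ∑ x, G.outWeight θ x * v x := by
  rw [← Finset.sum_fiberwise Finset.univ G.tail]
  refine Finset.sum_congr rfl fun x _ => ?_
  rw [outWeight, Finset.sum_mul]
  exact Finset.sum_congr rfl fun e he => by rw [(Finset.mem_filter_univ e).1 he]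

theorem vecMul_transitionMatrix (p : E → ℝ) (g : U → ℝ) :
    Matrix.vecMul g (G.transitionMatrix p) =
      Matrix.vecMul (fun e => g (G.tail e) * p e) G.headMatrix := by
  ext y
  rw [vecMul_headMatrix, ← Finset.sum_fiberwise _ G.tail]
  refine Finset.sum_congr rfl fun x _ => ?_
  change g x * G.transitionMatrix p x y = _
  rw [transitionMatrix_apply, Finset.mul_sum, Finset.filter_filter]
  refine Finset.sum_congr (Finset.filter_congr fun e _ => and_comm) fun e he => ?_
  rw [((Finset.mem_filter_univ e).1 he).2]

end HeadMatrix

theorem hat_tail_inl (e : E) : G.hat.tail (Sum.inl e) = (true, G.tail e) := rfl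

theorem hat_tail_inr (x : U) : G.hat.tail (Sum.inr x) = (false, x) := rfl

theorem hat_head_inl (e : E) : G.hat.head (Sum.inl e) = (G.head e).map (Prod.mk false) := rfl

theorem hat_head_inr (x : U) : G.hat.head (Sum.inr x) = some (true, x) := rfl

section Flows

variable [Fintype U] [DecidableEq U] [Fintype E] {x₀ : U} {p : E → ℝ}

theorem mem_hat_flowSpace_iff {θ : E → ℝ} {g : U → ℝ} :
    Sum.elim θ g ∈ G.hat.flowSpace (false, x₀) ↔
      G.outWeight θ = g ∧ g - Matrix.vecMul θ G.headMatrix = Pi.single x₀ 1 := by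
  have hplus (x : U) : G.hat.divergence (Sum.elim θ g) (true, x) = G.outWeight θ x - g x := by
    simp only [divergence, Finset.sum_filter, Fintype.sum_sum_type, hat_tail_inl, hat_tail_inr,
      hat_head_inl, hat_head_inr, outWeight]
    simp
  have hminus (x : U) : G.hat.divergence (Sum.elim θ g) (false, x) =
      (g - Matrix.vecMul θ G.headMatrix) x := by
    rw [Pi.sub_apply, vecMul_headMatrix]
    simp only [divergence, Finset.sum_filter, Fintype.sum_sum_type, hat_tail_inl, hat_tail_inr,
      hat_head_inl, hat_head_inr]
    simp
  simp only [flowSpace, Set.mem_ofPred_eq, funext_iff, Prod.forall, Bool.forall_bool, hplus,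
    hminus, Pi.single_apply, Prod.mk.injEq, true_and, reduceCtorEq, false_and, if_false,
    sub_eq_zero]
  exact and_comm

theorem elim_tail_mul_mem_flowSpace_iff (hp : ∀ x, ∑ e with G.tail e = x, p e = 1) {g : U → ℝ}
    (hdet : (1 - G.transitionMatrix p).det ≠ 0) :
    Sum.elim (fun e => g (G.tail e) * p e) g ∈ G.hat.flowSpace (false, x₀) ↔
      g = G.green p x₀ := by
  rw [mem_hat_flowSpace_iff, and_iff_right (outWeight_tail_mul hp g), ← vecMul_transitionMatrix,
    ← Matrix.vecMul_one g, Matrix.vecMul_vecMul, Matrix.one_mul, ← Matrix.vecMul_sub,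
    vecMul_eq_iff_eq_vecMul_inv hdet.isUnit, Matrix.vecMul_one, Matrix.single_one_vecMul]
  rfl

/-- The flow on the bipartite graph given by the expected numbers of crossings and of visits of
the chain in the environment `p`. -/
def occupationFlow (G : KilledGraph U E) (x₀ : U) (p : E → ℝ) : E ⊕ U → ℝ :=
  Sum.elim (G.occupation x₀ p) (G.green p x₀)

theorem occupationFlow_mem_flowSpace (hp : p ∈ G.environments)
    (hdet : (1 - G.transitionMatrix p).det ≠ 0) :
    G.occupationFlow x₀ p ∈ G.hat.flowSpace (false, x₀) :=
  (elim_tail_mul_mem_flowSpace_iff hp.2 hdet).2 rfl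

end Flows

/-- The environment whose exit probabilities are proportional to the flow `z`. -/
def flowEnv (G : KilledGraph U E) (z : E ⊕ U → ℝ) (e : E) : ℝ :=
  z (Sum.inl e) / z (Sum.inr (G.tail e))

section FlowEnv

variable [Fintype U] [DecidableEq U] [Fintype E] {x₀ : U} {p : E → ℝ}
  {z : E ⊕ U → ℝ}

theorem flowEnv_mem_environments (hz : z ∈ G.hat.flowSpace (false, x₀)) (hpos : ∀ f, 0 < z f) :
    G.flowEnv z ∈ G.environments := by
  have hp (e : E) : 0 < G.flowEnv z e := div_pos (hpos _) (hpos _)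
  have hsum (x : U) : ∑ e with G.tail e = x, G.flowEnv z e = 1 := by
    rw [← Sum.elim_comp_inl_inr z] at hz
    calc ∑ e with G.tail e = x, G.flowEnv z e = G.outWeight (z ∘ Sum.inl) x / z (Sum.inr x) := by
          rw [outWeight, Finset.sum_div]
          refine Finset.sum_congr rfl fun e he => ?_
          rw [flowEnv, (Finset.mem_filter_univ e).1 he, Function.comp_apply]
      _ = 1 := by
          rw [(mem_hat_flowSpace_iff.1 hz).1, Function.comp_apply, div_self (hpos _).ne']
  refine ⟨fun e => ⟨hp e, ?_⟩, hsum⟩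
  rw [← hsum (G.tail e)]
  exact Finset.single_le_sum (fun f _ => (hp f).le) ((Finset.mem_filter_univ e).2 rfl)

theorem occupationFlow_flowEnv (hz : z ∈ G.hat.flowSpace (false, x₀)) (hpos : ∀ f, 0 < z f)
    (hdet : (1 - G.transitionMatrix (G.flowEnv z)).det ≠ 0) :
    G.occupationFlow x₀ (G.flowEnv z) = z := by
  have helim : Sum.elim (fun e => z (Sum.inr (G.tail e)) * G.flowEnv z e) (z ∘ Sum.inr) = z := by
    simp only [flowEnv, mul_div_cancel₀ _ (hpos _).ne']
    exact Sum.elim_comp_inl_inr z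
  have hgreen : z ∘ Sum.inr = G.green (G.flowEnv z) x₀ := by
    rw [← elim_tail_mul_mem_flowSpace_iff (flowEnv_mem_environments hz hpos).2 hdet]
    exact helim.symm ▸ hz
  refine Eq.trans ?_ helim
  rw [occupationFlow, ← hgreen]
  congr 1
  ext e
  rw [occupation, ← hgreen]
  rfl

end FlowEnv

theorem flowEnv_occupationFlow [Fintype U] [DecidableEq U] [Fintype E] {x₀ : U} {p : E → ℝ}
    (hgreen : ∀ x, G.green p x₀ x ≠ 0) : G.flowEnv (G.occupationFlow x₀ p) = p :=
  funext fun e => mul_div_cancel_left₀ (p e) (hgreen (G.tail e))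

section FlowCoordinates

variable [DecidableEq U]

/-- The effect on the arrivals at the vertices of moving a unit of flow, at the origin of an edge
`e`, from the edge of the section `t` to `e`. -/
def coordIncidence (G : KilledGraph U E) (t : U → E) : Matrix (G.Coord t) U ℝ :=
  Matrix.of fun e y => G.headMatrix e y - G.sectionMatrix t (G.tail e) y

variable [Fintype U] [Fintype E] [DecidableEq E] {x₀ : U} {t : U → E}

theorem vecMul_headMatrix_eq (ht : ∀ x, G.tail (t x) = x) (θ : E → ℝ) :
    Matrix.vecMul θ G.headMatrix =
      Matrix.vecMul (fun e : G.Coord t => θ e) (G.coordIncidence t) +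
        Matrix.vecMul (G.outWeight θ) (G.sectionMatrix t) := by
  ext y
  have hsection (x : U) : G.headMatrix (t x) y - G.sectionMatrix t (G.tail (t x)) y = 0 := by
    rw [ht]
    exact sub_self _
  have hsplit := sum_eq_sum_section_add ht fun e =>
    θ e * (G.headMatrix e y - G.sectionMatrix t (G.tail e) y)
  simp only [hsection, mul_zero, Finset.sum_const_zero, zero_add] at hsplit
  rw [Pi.add_apply, ← sub_eq_iff_eq_add]
  refine Eq.trans ?_ hsplit
  simp only [mul_sub, Finset.sum_sub_distrib, sum_mul_tail θ fun x => G.sectionMatrix t x y]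
  rfl

/-- The flow through the vertices, in terms of the flow through the edges off the section `t`. -/
def flowMass (x₀ : U) (t : U → E) (w : G.Coord t → ℝ) : U → ℝ :=
  Matrix.vecMul (Pi.single x₀ 1 + Matrix.vecMul w (G.coordIncidence t)) (1 - G.sectionMatrix t)⁻¹

/-- The flow on the bipartite graph with given values off the section `t`. -/
def flowExtend (x₀ : U) (t : U → E) (w : G.Coord t → ℝ) : E ⊕ U → ℝ :=
  Sum.elim (G.fiberExtend t (flowMass x₀ t w) w) (flowMass x₀ t w)

theorem elim_mem_flowSpace_iff (ht : ∀ x, G.tail (t x) = x) (habs : G.Absorbing t) {θ : E → ℝ}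
    {g : U → ℝ} :
    Sum.elim θ g ∈ G.hat.flowSpace (false, x₀) ↔
      G.outWeight θ = g ∧ g = flowMass x₀ t fun e : G.Coord t => θ e := by
  have hunit : IsUnit (1 - G.sectionMatrix t).det :=
    habs.det_one_sub_sectionMatrix.symm ▸ isUnit_one
  rw [mem_hat_flowSpace_iff]
  refine and_congr_right fun hθ => ?_
  rw [flowMass, ← vecMul_eq_iff_eq_vecMul_inv hunit, Matrix.vecMul_sub, Matrix.vecMul_one,
    vecMul_headMatrix_eq ht, hθ, ← sub_sub, sub_right_comm, sub_eq_iff_eq_add]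

theorem flowExtend_mem_flowSpace (ht : ∀ x, G.tail (t x) = x) (habs : G.Absorbing t)
    (w : G.Coord t → ℝ) : flowExtend x₀ t w ∈ G.hat.flowSpace (false, x₀) :=
  (elim_mem_flowSpace_iff ht habs).2
    ⟨funext fun x => sum_fiberExtend ht _ w x, by simp only [fiberExtend_coord]⟩

theorem flowExtend_restrict (ht : ∀ x, G.tail (t x) = x) (habs : G.Absorbing t) {z : E ⊕ U → ℝ}
    (hz : z ∈ G.hat.flowSpace (false, x₀)) :
    flowExtend x₀ t (fun e : G.Coord t => z (Sum.inl e)) = z := by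
  obtain ⟨θ, g, rfl⟩ : ∃ θ g, z = Sum.elim θ g := ⟨_, _, (Sum.elim_comp_inl_inr z).symm⟩
  obtain ⟨hout, hmass⟩ := (elim_mem_flowSpace_iff ht habs).1 hz
  simp only [flowExtend, Sum.elim_inl, ← hmass, fiberExtend_restrict ht (congrFun hout)]

end FlowCoordinates

/-! ### Change of variables -/

section FlowChart

variable [Fintype U] [DecidableEq U]

/-- The matrix of the map that distributes the mass at every vertex over the edges off the
section `t` according to the exit probabilities `q`. -/
def coordTransition {t : U → E} (q : G.Coord t → ℝ) : Matrix U (G.Coord t) ℝ :=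
  Matrix.of fun x e => if G.tail e = x then q e else 0

theorem vecMul_coordTransition {t : U → E} (q : G.Coord t → ℝ) (g : U → ℝ) :
    Matrix.vecMul g (coordTransition q) = fun e : G.Coord t => g (G.tail e) * q e := by
  ext e
  simp [Matrix.vecMul, dotProduct, coordTransition]

variable [Fintype E] [DecidableEq E] {x₀ : U} {t : U → E}

/-- The coordinates of the positive flows on the bipartite graph. -/
def flowCone (G : KilledGraph U E) (x₀ : U) (t : U → E) : Set (G.Coord t → ℝ) :=
  {w | ∀ f, 0 < flowExtend x₀ t w f}

/-- The map `flowEnv`, which sends a flow to an environment, in the coordinates off the section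
`t`. -/
def flowChart (x₀ : U) (t : U → E) (w : G.Coord t → ℝ) (e : G.Coord t) : ℝ :=
  w e / flowMass x₀ t w (G.tail e)

theorem det_one_sub_coordIncidence_mul (ht : ∀ x, G.tail (t x) = x) (habs : G.Absorbing t)
    {p : E → ℝ} (hp : ∀ x, ∑ e with G.tail e = x, p e = 1) :
    (1 - G.coordIncidence t * (1 - G.sectionMatrix t)⁻¹ *
      coordTransition fun e : G.Coord t => p e).det = (1 - G.transitionMatrix p).det := by
  have hS := habs.det_one_sub_sectionMatrix
  have hproduct : coordTransition (fun e : G.Coord t => p e) * G.coordIncidence t =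
      G.transitionMatrix p - G.sectionMatrix t := by
    refine Matrix.ext_iff_vecMul.2 fun g => ?_
    rw [← Matrix.vecMul_vecMul, vecMul_coordTransition, Matrix.vecMul_sub, vecMul_transitionMatrix,
      vecMul_headMatrix_eq ht, outWeight_tail_mul hp, add_sub_cancel_right]
  have hfactor : (1 - (G.transitionMatrix p - G.sectionMatrix t) * (1 - G.sectionMatrix t)⁻¹) *
      (1 - G.sectionMatrix t) = 1 - G.transitionMatrix p := by
    rw [Matrix.sub_mul, Matrix.nonsing_inv_mul_cancel_right _ _ (hS ▸ isUnit_one), Matrix.one_mul,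
      sub_sub_sub_cancel_right]
  rw [Matrix.det_one_sub_mul_comm, ← Matrix.mul_assoc, hproduct, ← hfactor, Matrix.det_mul, hS,
    mul_one]

/-- The Jacobian matrix of `flowChart`. -/
def flowJacobian (x₀ : U) (t : U → E) (w : G.Coord t → ℝ) : Matrix (G.Coord t) (G.Coord t) ℝ :=
  Matrix.diagonal (fun e : G.Coord t => (flowMass x₀ t w (G.tail e))⁻¹) *
    (1 - G.coordIncidence t * (1 - G.sectionMatrix t)⁻¹ *
      coordTransition (flowChart x₀ t w)).transpose

theorem hasFDerivAt_flowMass (w : G.Coord t → ℝ) :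
    HasFDerivAt (flowMass x₀ t) (LinearMap.toContinuousLinearMap
      (Matrix.vecMulLinear (G.coordIncidence t * (1 - G.sectionMatrix t)⁻¹))) w := by
  have haffine : flowMass x₀ t = fun w : G.Coord t → ℝ =>
      Matrix.vecMul (Pi.single x₀ 1) (1 - G.sectionMatrix t)⁻¹ +
        LinearMap.toContinuousLinearMap
          (Matrix.vecMulLinear (G.coordIncidence t * (1 - G.sectionMatrix t)⁻¹)) w := by
    ext1 w
    rw [flowMass, Matrix.add_vecMul, Matrix.vecMul_vecMul]
    rfl
  rw [haffine]
  exact (ContinuousLinearMap.hasFDerivAt _).const_add _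

theorem isOpen_flowCone : IsOpen (G.flowCone x₀ t) := by
  have hmass (x : U) : Continuous fun w : G.Coord t → ℝ => flowMass x₀ t w x :=
    (continuous_apply x).comp
      (continuous_iff_continuousAt.2 fun w => (hasFDerivAt_flowMass w).continuousAt)
  simp only [flowCone, Set.ofPred_forall]
  refine isOpen_iInter_of_finite fun f => isOpen_lt continuous_const ?_
  rcases f with e | x
  · simp only [flowExtend, Sum.elim_inl, fiberExtend, coordSum]
    split_ifs <;> fun_prop
  · exact hmass x

theorem hasFDerivAt_flowChart {w : G.Coord t → ℝ} (hw : w ∈ G.flowCone x₀ t) :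
    HasFDerivAt (flowChart x₀ t)
      (LinearMap.toContinuousLinearMap (Matrix.toLin' (flowJacobian x₀ t w))) w := by
  refine hasFDerivAt_pi'.2 fun e => ?_
  have hmass : flowMass x₀ t w (G.tail e) ≠ 0 := (hw (Sum.inr (G.tail e))).ne'
  have hquot := (hasFDerivAt_apply (𝕜 := ℝ) e w).mul
    ((hasDerivAt_inv hmass).comp_hasFDerivAt w
      (hasFDerivAt_pi'.1 (hasFDerivAt_flowMass w) (G.tail e)))
  refine hquot.congr_fderiv (ContinuousLinearMap.ext fun v => ?_)
  have hJ : Matrix.mulVec (flowJacobian x₀ t w) v e = (flowMass x₀ t w (G.tail e))⁻¹ *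
      (v e - Matrix.vecMul v (G.coordIncidence t * (1 - G.sectionMatrix t)⁻¹) (G.tail e) *
        flowChart x₀ t w e) := by
    rw [flowJacobian, ← Matrix.mulVec_mulVec, Matrix.mulVec_diagonal, Matrix.mulVec_transpose,
      Matrix.vecMul_sub, Matrix.vecMul_one, Pi.sub_apply, ← Matrix.vecMul_vecMul,
      vecMul_coordTransition]
  refine Eq.trans ?_ hJ.symm
  simp only [neg_smul, smul_neg, Function.comp_apply, add_apply, neg_apply, smul_apply,
    ContinuousLinearMap.comp_apply, LinearMap.coe_toContinuousLinearMap', LinearMap.flip_apply,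
    Matrix.vecMulBilin_apply, ContinuousLinearMap.proj_apply, smul_eq_mul, flowChart]
  field_simp
  ring

theorem flowEnv_flowExtend (x₀ : U) (w : G.Coord t → ℝ) (e : G.Coord t) :
    G.flowEnv (flowExtend x₀ t w) e = flowChart x₀ t w e := by
  simp only [flowEnv, flowExtend, Sum.elim_inl, Sum.elim_inr, fiberExtend_coord, flowChart]

theorem flowEnv_flowExtend_mem_environments (ht : ∀ x, G.tail (t x) = x) (habs : G.Absorbing t)
    {w : G.Coord t → ℝ} (hw : w ∈ G.flowCone x₀ t) :
    G.flowEnv (flowExtend x₀ t w) ∈ G.environments :=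
  flowEnv_mem_environments (flowExtend_mem_flowSpace ht habs w) hw

theorem det_flowJacobian (ht : ∀ x, G.tail (t x) = x) (habs : G.Absorbing t)
    {w : G.Coord t → ℝ} (hw : w ∈ G.flowCone x₀ t) :
    (flowJacobian x₀ t w).det = (∏ e : G.Coord t, (flowMass x₀ t w (G.tail e))⁻¹) *
      (1 - G.transitionMatrix (G.flowEnv (flowExtend x₀ t w))).det := by
  have hp := flowEnv_flowExtend_mem_environments ht habs hw
  rw [flowJacobian, Matrix.det_mul, Matrix.det_diagonal, Matrix.det_transpose,
    ← det_one_sub_coordIncidence_mul ht habs hp.2]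
  simp only [flowEnv_flowExtend]

theorem occupationFlow_flowEnv_flowExtend (ht : ∀ x, G.tail (t x) = x) (habs : G.Absorbing t)
    {w : G.Coord t → ℝ} (hw : w ∈ G.flowCone x₀ t) :
    G.occupationFlow x₀ (G.flowEnv (flowExtend x₀ t w)) = flowExtend x₀ t w :=
  occupationFlow_flowEnv (flowExtend_mem_flowSpace ht habs w) hw
    (det_one_sub_transitionMatrix_pos (flowEnv_flowExtend_mem_environments ht habs hw) ht habs).ne'

theorem fiberExtend_flowChart (ht : ∀ x, G.tail (t x) = x) (habs : G.Absorbing t)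
    {w : G.Coord t → ℝ} (hw : w ∈ G.flowCone x₀ t) :
    G.fiberExtend t 1 (flowChart x₀ t w) = G.flowEnv (flowExtend x₀ t w) := by
  have hp := flowEnv_flowExtend_mem_environments ht habs hw
  rw [← fiberExtend_restrict ht (c := 1) hp.2]
  simp only [flowEnv_flowExtend]

theorem injOn_flowChart (ht : ∀ x, G.tail (t x) = x) (habs : G.Absorbing t) :
    Set.InjOn (flowChart x₀ t) (G.flowCone x₀ t) := by
  intro w hw w' hw' h
  have hflow : flowExtend x₀ t w = flowExtend x₀ t w' := by
    rw [← occupationFlow_flowEnv_flowExtend ht habs hw,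
      ← occupationFlow_flowEnv_flowExtend ht habs hw', ← fiberExtend_flowChart ht habs hw,
      ← fiberExtend_flowChart ht habs hw', h]
  ext e
  simpa only [flowExtend, Sum.elim_inl, fiberExtend_coord] using congrFun hflow (Sum.inl e)

theorem image_flowChart (ht : ∀ x, G.tail (t x) = x) (habs : G.Absorbing t)
    (hG : ∀ x, G.ContainsDirectedPath Set.univ (some x₀) (some x)) :
    flowChart x₀ t '' G.flowCone x₀ t = Set.range (envCoord t) := by
  ext q
  constructor
  · rintro ⟨w, hw, rfl⟩
    exact ⟨⟨_, flowEnv_flowExtend_mem_environments ht habs hw⟩,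
      funext fun e => flowEnv_flowExtend x₀ w e⟩
  · rintro ⟨⟨p, hp⟩, rfl⟩
    have hdet := (det_one_sub_transitionMatrix_pos hp ht habs).ne'
    have hpos : ∀ f, 0 < G.occupationFlow x₀ p f := Sum.rec
      (fun e => occupation_pos hp hdet hG e) fun x => green_pos hp hdet (hG x)
    have hflow := flowExtend_restrict ht habs (occupationFlow_mem_flowSpace (x₀ := x₀) hp hdet)
    refine ⟨fun e => G.occupationFlow x₀ p (Sum.inl e), ?_, funext fun e => ?_⟩
    · rw [flowCone, Set.mem_ofPred_eq, hflow]
      exact hpos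
    · rw [← flowEnv_flowExtend, hflow,
        flowEnv_occupationFlow fun x => (hpos (Sum.inr x)).ne']
      rfl

end FlowChart

section HatCoord

variable [Fintype U] [DecidableEq E] {t : U → E}

theorem inl_notMem_hatTree_iff (ht : ∀ x, G.tail (t x) = x) (e : E) :
    (Sum.inl e : E ⊕ U) ∉ hatTree (Finset.univ.image t) ↔ e ≠ t (G.tail e) := by
  simp only [hatTree, Finset.inl_mem_disjSum, Finset.mem_image, Finset.mem_univ, true_and]
  exact not_congr ⟨fun ⟨x, hx⟩ => by rw [← hx, ht], fun h => ⟨_, h.symm⟩⟩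

/-- The edges of the bipartite graph off the tree associated with the section `t` are the edges
off `t`. -/
def hatCoordEquiv (ht : ∀ x, G.tail (t x) = x) :
    G.Coord t ≃ {f : E ⊕ U // f ∉ hatTree (Finset.univ.image t)} :=
  Equiv.ofBijective (fun e => ⟨Sum.inl e, (inl_notMem_hatTree_iff ht e).2 e.2⟩)
    ⟨fun _ _ h => Subtype.ext (Sum.inl_injective (congrArg Subtype.val h)), by
      rintro ⟨e | x, h⟩
      · exact ⟨⟨e, (inl_notMem_hatTree_iff ht e).1 h⟩, rfl⟩
      · exact absurd (by simp [hatTree]) h⟩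

theorem prod_compl_hatTree [Fintype E] [DecidableEq U] {M : Type*} [CommMonoid M]
    (ht : ∀ x, G.tail (t x) = x) (f : E ⊕ U → M) :
    ∏ i ∈ (hatTree (Finset.univ.image t))ᶜ, f i = ∏ e : G.Coord t, f (Sum.inl e) := by
  rw [Finset.prod_subtype _ (fun _ => Finset.mem_compl)]
  exact ((hatCoordEquiv ht).prod_comp fun i => f i).symm

end HatCoord

section HatVolume

variable [Fintype U] [DecidableEq U] [Fintype E] {x₀ : U} {t : U → E}

/-- The coordinates off the section `t` of a flow on the bipartite graph. -/
def flowCoord (x₀ : U) (t : U → E) (z : G.hat.flowSpace (false, x₀)) (e : G.Coord t) : ℝ :=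
  (z : E ⊕ U → ℝ) (Sum.inl e)

theorem flowExtend_flowCoord [DecidableEq E] (ht : ∀ x, G.tail (t x) = x) (habs : G.Absorbing t)
    (z : G.hat.flowSpace (false, x₀)) : flowExtend x₀ t (flowCoord x₀ t z) = z :=
  flowExtend_restrict ht habs z.2

theorem surjective_flowCoord (ht : ∀ x, G.tail (t x) = x) (habs : G.Absorbing t) :
    Function.Surjective (flowCoord (G := G) x₀ t) := by
  classical
  exact fun w => ⟨⟨_, flowExtend_mem_flowSpace ht habs w⟩,
    funext fun e => fiberExtend_coord _ w e⟩

theorem measurableEmbedding_flowCoord (ht : ∀ x, G.tail (t x) = x) (habs : G.Absorbing t) :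
    MeasurableEmbedding (flowCoord (G := G) x₀ t) := by
  classical
  have hclosed : IsClosed (G.hat.flowSpace (false, x₀)) := by
    refine isClosed_eq (continuous_pi fun v => ?_) continuous_const
    simp only [divergence]
    fun_prop
  have := hclosed.measurableSet.standardBorel
  refine Measurable.measurableEmbedding (measurable_pi_lambda _ fun e =>
    (measurable_pi_apply (Sum.inl (e : E))).comp measurable_subtype_coe) fun z z' h =>
      Subtype.ext ?_
  rw [← flowExtend_flowCoord ht habs z, ← flowExtend_flowCoord ht habs z', h]

variable [DecidableEq E]

theorem measurePreserving_flowCoord (ht : ∀ x, G.tail (t x) = x) (habs : G.Absorbing t) :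
    MeasurePreserving (flowCoord (G := G) x₀ t)
      (G.hat.coordVolume (false, x₀) (hatTree (Finset.univ.image t))) volume := by
  let reindex := MeasurableEquiv.arrowCongr' (hatCoordEquiv ht) (MeasurableEquiv.refl ℝ)
  have hcomp : (fun (z : G.hat.flowSpace (false, x₀))
      (f : {f : E ⊕ U // f ∉ hatTree (Finset.univ.image t)}) => (z : E ⊕ U → ℝ) f) =
      reindex ∘ flowCoord x₀ t := by
    ext z f
    obtain ⟨e, rfl⟩ := (hatCoordEquiv ht).surjective f
    simp [reindex, MeasurableEquiv.arrowCongr', Equiv.arrowCongr', Equiv.arrowCongr]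
    rfl
  have hemb := measurableEmbedding_flowCoord (x₀ := x₀) ht habs
  refine ⟨hemb.measurable, ?_⟩
  rw [coordVolume, hcomp, comap_comp_of_measurePreserving hemb
    (reindex.measurableEmbedding.comp hemb)
    (volume_preserving_arrowCongr' _ _ (MeasurePreserving.id volume)) reindex.injective,
    hemb.map_comap, (surjective_flowCoord ht habs).range_eq, Measure.restrict_univ]

theorem preimage_flowCone (ht : ∀ x, G.tail (t x) = x) (habs : G.Absorbing t) :
    flowCoord x₀ t ⁻¹' G.flowCone x₀ t = G.hat.domain (false, x₀) := by
  ext z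
  simp only [Set.mem_preimage, flowCone, Set.mem_ofPred_eq, flowExtend_flowCoord ht habs]
  rfl

theorem hat_hyperIntegrable_iff (ht : ∀ x, G.tail (t x) = x) (habs : G.Absorbing t)
    (a : E ⊕ U → ℝ) (l : E ⊕ U → ℂ) :
    G.hat.HyperIntegrable (false, x₀) (hatTree (Finset.univ.image t)) a l ↔
      IntegrableOn (fun w => hyperIntegrand (hatTree (Finset.univ.image t)) a l
        (flowExtend x₀ t w)) (G.flowCone x₀ t) := by
  rw [← (measurePreserving_flowCoord ht habs).integrableOn_comp_preimage
    (measurableEmbedding_flowCoord ht habs), preimage_flowCone ht habs]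
  simp only [Function.comp_def, flowExtend_flowCoord ht habs]
  rfl

theorem hat_hyperIntegral_eq (ht : ∀ x, G.tail (t x) = x) (habs : G.Absorbing t)
    (a : E ⊕ U → ℝ) (l : E ⊕ U → ℂ) :
    G.hat.hyperIntegral (false, x₀) (hatTree (Finset.univ.image t)) a l =
      ∫ w in G.flowCone x₀ t, hyperIntegrand (hatTree (Finset.univ.image t)) a l
        (flowExtend x₀ t w) := by
  rw [← (measurePreserving_flowCoord ht habs).setIntegral_preimage_emb
    (measurableEmbedding_flowCoord ht habs), preimage_flowCone ht habs]
  simp only [flowExtend_flowCoord ht habs]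
  rfl

end HatVolume

section DirichletCoordinates

variable [Fintype U] [DecidableEq U] [Fintype E]

/-- The density of the Dirichlet law with weights `α`. -/
def dirichletDensity (G : KilledGraph U E) (α p : E → ℝ) : ℝ :=
  G.normConst α * ∏ e, p e ^ (α e - 1)

variable {r t : U → E} {α : E → ℝ}

theorem dirichletDensity_nonneg (hr : ∀ x, G.tail (r x) = x) (hα : ∀ e, 0 < α e) {p : E → ℝ}
    (hp : p ∈ G.environments) : 0 ≤ G.dirichletDensity α p :=
  mul_nonneg (normConst_pos hr hα).le
    (Finset.prod_nonneg fun e _ => Real.rpow_nonneg (hp.1 e).1.le _)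

theorem measurable_dirichletDensity :
    Measurable fun p : G.environments => ENNReal.ofReal (G.dirichletDensity α p) :=
  (measurable_const.mul (Finset.measurable_prod _ fun e _ =>
    (measurable_environment_apply e).pow_const _)).ennreal_ofReal

variable [DecidableEq E] {F : Type*} [NormedAddCommGroup F] [NormedSpace ℝ F]

theorem integrable_dirichletLaw_iff (hr : ∀ x, G.tail (r x) = x) (ht : ∀ x, G.tail (t x) = x)
    (hα : ∀ e, 0 < α e) (f : (E → ℝ) → F) :
    Integrable (fun p : G.environments => f p) (G.dirichletLaw r α) ↔
      IntegrableOn (fun q => G.dirichletDensity α (G.fiberExtend t 1 q) •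
        f (G.fiberExtend t 1 q)) (Set.range (envCoord t)) := by
  have hemb := measurableEmbedding_envCoord ht
  rw [dirichletLaw, environmentVolume_congr hr ht]
  refine (integrable_withDensity_iff_integrable_smul' measurable_dirichletDensity
    (.of_forall fun _ => ENNReal.ofReal_lt_top)).trans ?_
  rw [IntegrableOn, ← hemb.map_comap, hemb.integrable_map_iff]
  simp only [Function.comp_def, fiberExtend_envCoord ht,
    ENNReal.toReal_ofReal (dirichletDensity_nonneg hr hα (Subtype.property _))]
  rfl

theorem integral_dirichletLaw_eq (hr : ∀ x, G.tail (r x) = x) (ht : ∀ x, G.tail (t x) = x)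
    (hα : ∀ e, 0 < α e) (f : (E → ℝ) → F) :
    ∫ p : G.environments, f p ∂(G.dirichletLaw r α) =
      ∫ q in Set.range (envCoord t),
        G.dirichletDensity α (G.fiberExtend t 1 q) • f (G.fiberExtend t 1 q) := by
  have hemb := measurableEmbedding_envCoord ht
  rw [dirichletLaw, environmentVolume_congr hr ht]
  refine (integral_withDensity_eq_integral_toReal_smul measurable_dirichletDensity
    (.of_forall fun _ => ENNReal.ofReal_lt_top) _).trans ?_
  rw [← hemb.map_comap, hemb.integral_map]
  simp only [fiberExtend_envCoord ht,
    ENNReal.toReal_ofReal (dirichletDensity_nonneg hr hα (Subtype.property _))]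
  rfl

end DirichletCoordinates

section Integrands

variable [Fintype U] [Fintype E]

theorem prod_rpow_sub_one_mul_prod_section [DecidableEq E] {t : U → E}
    (ht : ∀ x, G.tail (t x) = x) {p : E → ℝ} (hp : ∀ e, 0 < p e) (α : E → ℝ) :
    (∏ e, p e ^ (α e - 1)) * ∏ x, p (t x) = (∏ e, p e ^ α e) * ∏ e : G.Coord t, (p e)⁻¹ := by
  have hsection : ∏ x, p (t x) ≠ 0 := (Finset.prod_pos fun x _ => hp _).ne'
  simp only [Real.rpow_sub_one (hp _).ne', Finset.prod_div_distrib, Finset.prod_inv_distrib,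
    prod_eq_prod_section_mul ht p]
  field_simp

variable [DecidableEq U]

theorem prod_rpow_tail {g : U → ℝ} (hg : ∀ x, 0 < g x) (α : E → ℝ) :
    ∏ e, g (G.tail e) ^ α e = ∏ x, g x ^ G.outWeight α x := by
  rw [← Finset.prod_fiberwise Finset.univ G.tail]
  refine Finset.prod_congr rfl fun x _ => ?_
  rw [outWeight, Real.rpow_sum_of_pos (hg x)]
  exact Finset.prod_congr rfl fun e he => by rw [(Finset.mem_filter_univ e).1 he]

/- The weights `-β_x` make the monomial invariant under rescaling of the flow at each vertex. -/
theorem prod_rpow_hatWeight {z : E ⊕ U → ℝ} (hz : ∀ f, 0 < z f) (α : E → ℝ) :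
    ∏ f, z f ^ G.hatWeight α f = ∏ e, G.flowEnv z e ^ α e := by
  have hmass : ∀ x, 0 < z (Sum.inr x) := fun x => hz _
  have hvertex : ∏ x, z (Sum.inr x) ^ (-G.outWeight α x) =
      (∏ e, z (Sum.inr (G.tail e)) ^ α e)⁻¹ := by
    rw [prod_rpow_tail hmass, ← Finset.prod_inv_distrib]
    exact Finset.prod_congr rfl fun x _ => Real.rpow_neg (hmass x).le _
  simp only [Fintype.prod_sum_type, hatWeight, Sum.elim_inl, Sum.elim_inr]
  rw [hvertex, ← div_eq_mul_inv, ← Finset.prod_div_distrib]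
  exact Finset.prod_congr rfl fun e _ => (Real.div_rpow (hz _).le (hmass _).le _).symm

theorem sum_hatParam_mul_occupationFlow (x₀ : U) (l : E → ℂ) (p : E → ℝ) :
    ∑ f, hatParam l f * (G.occupationFlow x₀ p f : ℂ) =
      ∑ e, l e * (G.occupation x₀ p e : ℂ) := by
  simp [Fintype.sum_sum_type, hatParam, occupationFlow]

variable [DecidableEq E] {t : U → E} {x₀ : U} {w : G.Coord t → ℝ}

theorem det_flowJacobian_pos (ht : ∀ x, G.tail (t x) = x) (habs : G.Absorbing t)
    (hw : w ∈ G.flowCone x₀ t) : 0 < (flowJacobian x₀ t w).det := by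
  rw [det_flowJacobian ht habs hw]
  exact mul_pos (Finset.prod_pos fun e _ => inv_pos.2 (hw (Sum.inr (G.tail e))))
    (det_one_sub_transitionMatrix_pos (flowEnv_flowExtend_mem_environments ht habs hw) ht habs)

theorem hyperIntegrand_flowExtend (ht : ∀ x, G.tail (t x) = x) (habs : G.Absorbing t)
    (hw : w ∈ G.flowCone x₀ t) (α : E → ℝ) (l : E → ℂ) :
    hyperIntegrand (hatTree (Finset.univ.image t)) (G.hatWeight α) (hatParam l)
        (flowExtend x₀ t w) =
      (((flowJacobian x₀ t w).det * ∏ e, G.flowEnv (flowExtend x₀ t w) e ^ (α e - 1) : ℝ) : ℂ) *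
        G.laplaceFunctional x₀ (Finset.univ.image t) l (G.flowEnv (flowExtend x₀ t w)) := by
  have hz := occupationFlow_flowEnv_flowExtend ht habs hw
  have hp := flowEnv_flowExtend_mem_environments ht habs hw
  have hdet := (det_one_sub_transitionMatrix_pos hp ht habs).ne'
  have hphase : ∑ f, hatParam l f * (flowExtend x₀ t w f : ℂ) =
      ∑ e, l e * (G.occupation x₀ (G.flowEnv (flowExtend x₀ t w)) e : ℂ) := by
    rw [← sum_hatParam_mul_occupationFlow, hz]
  have hcoord (e : G.Coord t) : (flowExtend x₀ t w (Sum.inl e))⁻¹ =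
      (flowMass x₀ t w (G.tail e))⁻¹ * (G.flowEnv (flowExtend x₀ t w) e)⁻¹ := by
    change _ = (flowExtend x₀ t w (Sum.inr (G.tail e)))⁻¹ * _
    rw [flowEnv, inv_div, inv_mul_eq_div, div_div_cancel_left' (hw _).ne']
  have hdensity : (∏ f, flowExtend x₀ t w f ^ G.hatWeight α f) *
      ∏ f ∈ (hatTree (Finset.univ.image t))ᶜ, (flowExtend x₀ t w f)⁻¹ =
      (flowJacobian x₀ t w).det * (∏ e, G.flowEnv (flowExtend x₀ t w) e ^ (α e - 1)) *
        ((∏ e ∈ Finset.univ.image t, G.flowEnv (flowExtend x₀ t w) e) /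
          (1 - G.transitionMatrix (G.flowEnv (flowExtend x₀ t w))).det) := by
    rw [prod_rpow_hatWeight hw, prod_compl_hatTree ht, det_flowJacobian ht habs hw,
      prod_image_section ht, Finset.prod_congr rfl fun e _ => hcoord e, Finset.prod_mul_distrib,
      mul_left_comm, ← prod_rpow_sub_one_mul_prod_section ht fun e => (hp.1 e).1]
    field_simp
  rw [hyperIntegrand, laplaceFunctional, hphase, mul_assoc, ← Complex.ofReal_mul, hdensity]
  push_cast
  ring

end Integrands

section ChangeOfVariables

variable [Fintype U] [DecidableEq U] [Fintype E]
  [DecidableEq E] {r t : U → E} {x₀ : U} {α : E → ℝ} {l : E → ℂ}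

theorem det_smul_dirichletDensity_smul (ht : ∀ x, G.tail (t x) = x) (habs : G.Absorbing t)
    (α : E → ℝ) (l : E → ℂ) {w : G.Coord t → ℝ} (hw : w ∈ G.flowCone x₀ t) :
    |(LinearMap.toContinuousLinearMap (Matrix.toLin' (flowJacobian x₀ t w))).det| •
      G.dirichletDensity α (G.fiberExtend t 1 (flowChart x₀ t w)) •
        G.laplaceFunctional x₀ (Finset.univ.image t) l (G.fiberExtend t 1 (flowChart x₀ t w)) =
      (G.normConst α : ℂ) * hyperIntegrand (hatTree (Finset.univ.image t)) (G.hatWeight α)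
        (hatParam l) (flowExtend x₀ t w) := by
  have hdet : (LinearMap.toContinuousLinearMap (Matrix.toLin' (flowJacobian x₀ t w))).det =
      (flowJacobian x₀ t w).det := LinearMap.det_toLin' _
  rw [hdet, abs_of_pos (det_flowJacobian_pos ht habs hw), fiberExtend_flowChart ht habs hw,
    hyperIntegrand_flowExtend ht habs hw, dirichletDensity, Complex.real_smul, Complex.real_smul]
  push_cast
  ring

theorem hat_hyperIntegrable_iff_integrable_dirichletLaw (hr : ∀ x, G.tail (r x) = x)
    (hα : ∀ e, 0 < α e) (ht : ∀ x, G.tail (t x) = x) (habs : G.Absorbing t)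
    (hG : ∀ x, G.ContainsDirectedPath Set.univ (some x₀) (some x)) :
    G.hat.HyperIntegrable (false, x₀) (hatTree (Finset.univ.image t)) (G.hatWeight α)
        (hatParam l) ↔
      Integrable (fun p : G.environments => G.laplaceFunctional x₀ (Finset.univ.image t) l p)
        (G.dirichletLaw r α) := by
  have hC : IsUnit (G.normConst α : ℂ) :=
    (Complex.ofReal_ne_zero.2 (normConst_pos hr hα).ne').isUnit
  have hmeas := (isOpen_flowCone (G := G) (x₀ := x₀) (t := t)).measurableSet
  rw [hat_hyperIntegrable_iff ht habs, integrable_dirichletLaw_iff hr ht hα,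
    ← image_flowChart ht habs hG, integrableOn_image_iff_integrableOn_abs_det_fderiv_smul volume
      hmeas (fun w hw => (hasFDerivAt_flowChart hw).hasFDerivWithinAt) (injOn_flowChart ht habs),
    integrableOn_congr_fun (fun w hw => det_smul_dirichletDensity_smul ht habs α l hw) hmeas]
  exact (integrable_const_mul_iff hC _).symm

theorem normConst_mul_hat_hyperIntegral (hr : ∀ x, G.tail (r x) = x) (hα : ∀ e, 0 < α e)
    (ht : ∀ x, G.tail (t x) = x) (habs : G.Absorbing t)
    (hG : ∀ x, G.ContainsDirectedPath Set.univ (some x₀) (some x)) (l : E → ℂ) :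
    (G.normConst α : ℂ) * G.hat.hyperIntegral (false, x₀) (hatTree (Finset.univ.image t))
        (G.hatWeight α) (hatParam l) =
      ∫ p : G.environments, G.laplaceFunctional x₀ (Finset.univ.image t) l p
        ∂(G.dirichletLaw r α) := by
  have hmeas := (isOpen_flowCone (G := G) (x₀ := x₀) (t := t)).measurableSet
  rw [hat_hyperIntegral_eq ht habs, integral_dirichletLaw_eq hr ht hα,
    ← image_flowChart ht habs hG, integral_image_eq_integral_abs_det_fderiv_smul volume hmeas
      (fun w hw => (hasFDerivAt_flowChart hw).hasFDerivWithinAt) (injOn_flowChart ht habs),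
    setIntegral_congr_fun hmeas fun w hw => det_smul_dirichletDensity_smul ht habs α l hw,
    integral_const_mul]

end ChangeOfVariables

end KilledGraph

theorem theorem2p1_general {U E : Type*} [Fintype U] [DecidableEq U] [Fintype E] [DecidableEq E]
    (G : KilledGraph U E) (x₀ : U)
    (hG : ∀ x, G.ContainsDirectedPath Set.univ (some x₀) (some x))
    (α : E → ℝ) (hα : ∀ e, 0 < α e)
    (r : U → E) (hr : ∀ x, G.tail (r x) = x)
    (T : Finset E) (hT : G.IsDirectedSpanningTree T)
    (l : E → ℂ) (hl : ∀ e, 0 ≤ (l e).re) :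
    G.hat.HyperIntegrable (false, x₀) (KilledGraph.hatTree T) (G.hatWeight α)
        (KilledGraph.hatParam l) ∧
      (∀ p ∈ G.environments, (1 - G.transitionMatrix p).det ≠ 0) ∧
      Integrable (fun p : G.environments => G.laplaceFunctional x₀ T l p) (G.dirichletLaw r α) ∧
      (G.normConst α : ℂ) *
          G.hat.hyperIntegral (false, x₀) (KilledGraph.hatTree T) (G.hatWeight α)
            (KilledGraph.hatParam l) =
        ∫ p : G.environments, G.laplaceFunctional x₀ T l p ∂(G.dirichletLaw r α) ∧
      ∀ p ∈ G.environments, ∀ {Ω : Type*} [MeasurableSpace Ω] (ℙ : Measure Ω)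
        (X : ℕ → Ω → Option U), G.IsMarkovChain x₀ p ℙ X →
          ∀ e, G.expectedCrossings ℙ X e = ENNReal.ofReal (G.occupation x₀ p e) := by
  obtain ⟨t, ht, habs, rfl⟩ := hT.exists_section
  have hdet : ∀ p ∈ G.environments, (1 - G.transitionMatrix p).det ≠ 0 := fun p hp =>
    (KilledGraph.det_one_sub_transitionMatrix_pos hp ht habs).ne'
  have hintegrable := KilledGraph.integrable_laplaceFunctional hr hα ht habs x₀ hl
  exact ⟨(KilledGraph.hat_hyperIntegrable_iff_integrable_dirichletLaw hr hα ht habs hG).2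
    hintegrable, hdet, hintegrable,
    KilledGraph.normConst_mul_hat_hyperIntegral hr hα ht habs hG l,
    fun p hp _ _ _ _ hX e => hX.expectedCrossings_eq hp (hdet p hp) e⟩

theorem theorem2p1 {U E : Type*} [Fintype U] [DecidableEq U] [Fintype E] [DecidableEq E]
    (G : KilledGraph U E) (x₀ : U) (hG : G.IsAdmissible x₀)
    (α : E → ℝ) (hα : ∀ e, 0 < α e)
    (r : U → E) (hr : ∀ x, G.tail (r x) = x)
    (T : Finset E) (hT : G.IsDirectedSpanningTree T)
    (l : E → ℂ) (hl : ∀ e, 0 < (l e).re) :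
    G.hat.HyperIntegrable (false, x₀) (KilledGraph.hatTree T) (G.hatWeight α)
        (KilledGraph.hatParam l) ∧
      (∀ p ∈ G.environments, (1 - G.transitionMatrix p).det ≠ 0) ∧
      Integrable (fun p : G.environments =>
        Complex.exp (-∑ e, l e * (G.occupation x₀ p e : ℂ)) *
          (((∏ e ∈ T, (p : E → ℝ) e) / (1 - G.transitionMatrix p).det : ℝ) : ℂ))
        (G.dirichletLaw r α) ∧
      (G.normConst α : ℂ) *
          G.hat.hyperIntegral (false, x₀) (KilledGraph.hatTree T) (G.hatWeight α)
            (KilledGraph.hatParam l) =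
        ∫ p : G.environments,
          Complex.exp (-∑ e, l e * (G.occupation x₀ p e : ℂ)) *
            (((∏ e ∈ T, (p : E → ℝ) e) / (1 - G.transitionMatrix p).det : ℝ) : ℂ)
          ∂(G.dirichletLaw r α) ∧
      ∀ p ∈ G.environments, ∀ {Ω : Type*} [MeasurableSpace Ω] (ℙ : Measure Ω)
        (X : ℕ → Ω → Option U), G.IsMarkovChain x₀ p ℙ X →
          ∀ e, G.expectedCrossings ℙ X e = ENNReal.ofReal (G.occupation x₀ p e) := by
  exact theorem2p1_general G x₀ hG.containsDirectedPath α hα r hr T hT l fun e => (hl e).le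

end
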